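/- Let $\Omega\subset\mathbb R^3$ be a bounded open set with boundary of class $C^2$ and outer unit normal $\nu$, let $\Gamma\subseteq\partial\Omega$ be relatively open, and let $ds$ be the surface measure on $\partial\Omega$. For $P\in H^1(\Omega,\mathbb R^{3\times3})$ put $(\mathrm DP)_{ijk}=\partial_kP_{ij}$; let $P\times\nu$ denote the row-wise cross product, $\operatorname{dev}A=A-\tfrac13\operatorname{tr}(A)\mathbb 1$, $(\mathfrak m\cdot\nu)_{ij}=\sum_h\mathfrak m_{ijh}\nu_h$ and $(\operatorname{DIV}\mathfrak m)_{ij}=\sum_k\partial_k\mathfrak m_{ijk}$. Let $$\mathscr H^\sharp(\Omega)=\{P\in H^1(\Omega,\mathbb R^{3\times3}) : P\times\nu|_\Gamma=0\}$$ (in the sense of traces). For real parameters $\mu,L_c,a_1,a_2,a_3$ consider the curvature energy $$\mathscr F_{\rm curv}[P]=\int_\Omega\frac{\mu L_c^2}{2}\Big(a_1\|\mathrm D(\operatorname{dev}\operatorname{sym}P)\|^2+a_2\|\mathrm D(\operatorname{skew}P)\|^2+\tfrac29a_3\|\mathrm D(\operatorname{tr}(P)\mathbb 1)\|^2\Big)dV,$$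 its first variation $\delta\mathscr F_{\rm curv}[P,\delta P]=\frac{d}{dt}\big|_{t=0}\mathscr F_{\rm curv}[P+t\,\delta P]$, and the moment stress tensor $$\mathfrak m=\mu L_c^2\Big(a_1\mathrm D(\operatorname{dev}\operatorname{sym}P)+a_2\mathrm D(\operatorname{skew}P)+\tfrac23a_3\mathrm D(\operatorname{tr}(P)\mathbb 1)\Big).$$ Let $P\in\mathscr H^\sharp(\Omega)\cap C^2(\overline\Omega,\mathbb R^{3\times3})$. 1. For every $\delta P\in\mathscr H^\sharp(\Omega)$ one has $\delta P=\delta P\cdot(\nu\otimes\nu)$ a.e. on $\Gamma$, the derivative defining $\delta\mathscr F_{\rm curv}[P,\delta P]$ exists, and, if $\overline\Gamma\setminus\Gamma$ has surface measure zero, $$\delta\mathscr F_{\rm curv}[P,\delta P]=\int_\Gamma\langle(\mathfrak m\cdot\nu)\cdot(\nu\otimes\nu),\delta P\cdot(\nu\otimes\nu)\rangle\,ds+\int_{\partial\Omega\setminus\overline\Gamma}\langle\mathfrak m\cdot\nu,\delta P\rangle\,ds-\int_\Omega\langle\operatorname{DIV}\mathfrak m,\delta P\rangle\,dV.$$ 2.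 If $\delta\mathscr F_{\rm curv}[P,\delta P]=0$ for all $\delta P\in\mathscr H^\sharp(\Omega)$, then $$\operatorname{DIV}\mathfrak m=0\ \text{in }\Omega,\qquad(\mathfrak m\cdot\nu)\cdot(\nu\otimes\nu)=0\ \text{on }\Gamma,\qquad\mathfrak m\cdot\nu=0\ \text{on }\partial\Omega\setminus\overline\Gamma.$$ Conversely, if $\overline\Gamma\setminus\Gamma$ has surface measure zero, these three conditions imply $\delta\mathscr F_{\rm curv}[P,\delta P]=0$ for all $\delta P\in\mathscr H^\sharp(\Omega)$. 3. At every point of $\Gamma$, $(\mathfrak m\cdot\nu)\cdot(\nu\otimes\nu)=0$ if and only if $(\mathfrak m\cdot\nu)\cdot\nu=0$. -/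

import Mathlib

open MeasureTheory Filter Topology

noncomputable section

namespace Micromorphic

/-- Euclidean three-space. -/
abbrev Vec3 := EuclideanSpace ℝ (Fin 3)

/-- Second order tensors. -/
abbrev Mat3 := Matrix (Fin 3) (Fin 3) ℝ

/-- Third order tensors. -/
abbrev Tensor3 := Fin 3 → Fin 3 → Fin 3 → ℝ

/-! ### Tensor algebra -/

/-- Symmetric part. -/
def sym (A : Mat3) : Mat3 := (1 / 2 : ℝ) • (A + A.transpose)

/-- Skew-symmetric part. -/
def skew (A : Mat3) : Mat3 := (1 / 2 : ℝ) • (A - A.transpose)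

/-- Deviatoric (trace-free) part. -/
def dev (A : Mat3) : Mat3 := A - (A.trace / 3) • (1 : Mat3)

/-- Frobenius scalar product of matrices. -/
def mdot (A B : Mat3) : ℝ := ∑ i, ∑ j, A i j * B i j

/-- Squared Euclidean norm of a third order tensor. -/
def tnormSq (M : Tensor3) : ℝ := ∑ i, ∑ j, ∑ k, M i j k ^ 2

/-- The linear operation `L` on matrices applied, for every fixed last index, to the first two
indices. If `M = D P` (that is, `M i j k = ∂ₖ Pᵢⱼ`) this is `D (L P)`. -/
def onSlices (L : Mat3 → Mat3) (M : Tensor3) : Tensor3 :=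
  fun i j k => L (Matrix.of fun i' j' => M i' j' k) i j

/-- The contraction `(m · u)ᵢⱼ = ∑ₕ mᵢⱼₕ uₕ`. -/
def tdot (m : Tensor3) (u : Vec3) : Mat3 := Matrix.of fun i j => ∑ h, m i j h * u h

/-- The contraction `(A · u)ᵢ = ∑ⱼ Aᵢⱼ uⱼ`. -/
def vdot (A : Mat3) (u : Vec3) : Fin 3 → ℝ := A.mulVec (fun j => u j)

/-- The dyadic square `u ⊗ u`. -/
def dyad (u : Vec3) : Mat3 := Matrix.of fun i j => u i * u j

/-- The row-wise cross product `(A × u)ᵢⱼ = ((A)ᵢ × u)ⱼ`. -/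
def rowCross (A : Mat3) (u : Vec3) : Mat3 :=
  Matrix.of fun i => crossProduct (fun j => A i j) (fun j => u j)

/-! ### Differential operators -/

/-- The `k`-th partial derivative. -/
def pderiv (k : Fin 3) (f : Vec3 → ℝ) (x : Vec3) : ℝ :=
  fderiv ℝ f x (EuclideanSpace.single k 1)

/-- The classical gradient `(D P)ᵢⱼₖ = ∂ₖ Pᵢⱼ`. -/
def grad (P : Vec3 → Mat3) (x : Vec3) : Tensor3 :=
  fun i j k => pderiv k (fun y => P y i j) x

/-- The divergence `(DIV m)ᵢⱼ = ∑ₖ ∂ₖ mᵢⱼₖ`. -/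
def DIV (m : Vec3 → Tensor3) (x : Vec3) : Mat3 :=
  Matrix.of fun i j => ∑ k, pderiv k (fun y => m y i j k) x

/-! ### Domains with `C²` boundary -/

/-- `ρ` is a `C²` defining function of `Ω` near the point `x`. -/
def IsDefiningFunctionAt (Ω : Set Vec3) (x : Vec3) (ρ : Vec3 → ℝ) : Prop :=
  ContDiff ℝ 2 ρ ∧ gradient ρ x ≠ 0 ∧ ∀ᶠ y in 𝓝 x, (y ∈ Ω ↔ ρ y < 0)

/-- `Ω` lies locally on one side of its boundary, which is a surface of class `C²`. -/
def HasC2Boundary (Ω : Set Vec3) : Prop :=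
  ∀ x ∈ frontier Ω, ∃ ρ, IsDefiningFunctionAt Ω x ρ

open Classical in
/-- The outer unit normal `∇ρ / |∇ρ|` of `Ω` at a boundary point, `ρ` being any local defining
function (the value does not depend on which one). -/
def outerNormal (Ω : Set Vec3) (x : Vec3) : Vec3 :=
  if h : ∃ ρ, IsDefiningFunctionAt Ω x ρ then ‖gradient h.choose x‖⁻¹ • gradient h.choose x else 0

/-- The surface measure on `∂Ω`: two-dimensional Hausdorff measure, normalized as surface area. -/
def surf (Ω : Set Vec3) : Measure Vec3 :=
  (Measure.euclideanHausdorffMeasure 2 : Measure Vec3).restrict (frontier Ω)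

/-! ### The Sobolev space `H¹`, traces, and the space `ℋ^♯` -/

/-- `P` and `G` are square integrable on `Ω`, and `G` is the weak gradient of `P` in `Ω`. -/
def HasWeakGrad (Ω : Set Vec3) (P : Vec3 → Mat3) (G : Vec3 → Tensor3) : Prop :=
  (∀ i j, MemLp (fun x => P x i j) 2 (volume.restrict Ω)) ∧
  (∀ i j k, MemLp (fun x => G x i j k) 2 (volume.restrict Ω)) ∧
  ∀ i j k, ∀ φ : Vec3 → ℝ, ContDiff ℝ (⊤ : ℕ∞) φ → HasCompactSupport φ → tsupport φ ⊆ Ω →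
    ∫ x in Ω, P x i j * pderiv k φ x = -∫ x in Ω, G x i j k * φ x

/-- `P ∈ H¹(Ω, ℝ^{3×3})`. -/
def MemH1 (Ω : Set Vec3) (P : Vec3 → Mat3) : Prop := ∃ G, HasWeakGrad Ω P G

open Classical in
/-- The weak gradient `D P` of `P ∈ H¹(Ω, ℝ^{3×3})` (unique up to null sets). -/
def weakGrad (Ω : Set Vec3) (P : Vec3 → Mat3) : Vec3 → Tensor3 :=
  if h : MemH1 Ω P then h.choose else 0

/-- `g ∈ L²(∂Ω, ℝ^{3×3})` is the boundary trace of `P ∈ H¹(Ω, ℝ^{3×3})`: the trace operator is the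
closure, in `H¹(Ω) × L²(∂Ω)`, of the restriction map on fields of class `C¹` up to the boundary. -/
def IsTrace (Ω : Set Vec3) (P g : Vec3 → Mat3) : Prop :=
  MemH1 Ω P ∧ (∀ i j, MemLp (fun x => g x i j) 2 (surf Ω)) ∧
  ∃ Q : ℕ → Vec3 → Mat3,
    (∀ n i j, ContDiff ℝ 1 (fun x => Q n x i j)) ∧
    (∀ i j, Tendsto (fun n => eLpNorm (fun x => Q n x i j - P x i j) 2 (volume.restrict Ω))
      atTop (𝓝 0)) ∧
    (∀ i j k, Tendsto
      (fun n => eLpNorm (fun x => grad (Q n) x i j k - weakGrad Ω P x i j k) 2 (volume.restrict Ω))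
      atTop (𝓝 0)) ∧
    (∀ i j, Tendsto (fun n => eLpNorm (fun x => Q n x i j - g x i j) 2 (surf Ω)) atTop (𝓝 0))

/-- The matrix field `g` has vanishing tangential part on `Γ`: `g × ν = 0` almost everywhere. -/
def TangentiallyZero (Ω Γ : Set Vec3) (g : Vec3 → Mat3) : Prop :=
  ∀ᵐ x ∂(surf Ω).restrict Γ, rowCross (g x) (outerNormal Ω x) = 0

/-- `P ∈ ℋ^♯(Ω)`: `P ∈ H¹(Ω, ℝ^{3×3})` and `P × ν = 0` on `Γ` in the sense of traces. -/
def MemHsharp (Ω Γ : Set Vec3) (P : Vec3 → Mat3) : Prop :=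
  ∃ g, IsTrace Ω P g ∧ TangentiallyZero Ω Γ g

/-! ### Curvature energy, moment stress -/

/-- The constitutive parameters of the curvature energy. -/
structure CurvParams where
  μ : ℝ
  Lc : ℝ
  a₁ : ℝ
  a₂ : ℝ
  a₃ : ℝ

/-- The curvature energy density as a function of `M = D P`, that is
`μ Lc² / 2 (a₁ |D dev sym P|² + a₂ |D skew P|² + 2/9 a₃ |D (tr P · 1)|²)`. -/
def Wcurv (c : CurvParams) (M : Tensor3) : ℝ :=
  c.μ * c.Lc ^ 2 / 2 *
    (c.a₁ * tnormSq (onSlices (fun A => dev (sym A)) M) + c.a₂ * tnormSq (onSlices skew M) +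
      2 / 9 * c.a₃ * tnormSq (onSlices (fun A => A.trace • (1 : Mat3)) M))

/-- The curvature energy functional on `H¹(Ω, ℝ^{3×3})`. -/
def curvEnergy (c : CurvParams) (Ω : Set Vec3) (P : Vec3 → Mat3) : ℝ :=
  ∫ x in Ω, Wcurv c (weakGrad Ω P x)

/-- The first variation (Gâteaux derivative) of the curvature energy at `P` in direction `δP`. -/
def curvVariation (c : CurvParams) (Ω : Set Vec3) (P δP : Vec3 → Mat3) : ℝ :=
  deriv (fun t : ℝ => curvEnergy c Ω (P + t • δP)) 0

/-- The third order moment stress tensor, conjugate to `D P` for the density `Wcurv`. The factor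
`2/3 = 3 · 2/9` of the last term is due to `⟨1, 1⟩ = 3`. -/
def momentStress (c : CurvParams) (P : Vec3 → Mat3) (x : Vec3) : Tensor3 :=
  (c.μ * c.Lc ^ 2) •
    (c.a₁ • grad (fun y => dev (sym (P y))) x + c.a₂ • grad (fun y => skew (P y)) x +
      (2 / 3 * c.a₃) • grad (fun y => (P y).trace • (1 : Mat3)) x)

end Micromorphic

end

open Micromorphic

open scoped NNReal ENNReal Manifold

noncomputable section

namespace Micromorphic

/-! The energy density is a quadratic form in the gradient, so the energy along `P + t • δP` is
exactly a quadratic polynomial in `t`, and the first variation is its linear coefficient, the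
integral of the pairing of the moment stress with the weak gradient of `δP` (`Wcurv_add_smul`,
`hasDerivAt_curvEnergy`). Since `P` is `C²`, the moment stress is `C¹`, and Green's formula moves
the derivative off `δP` (`IsTrace.integral_tensorInner_weakGrad`). On `Γ` the condition `g × ν = 0`
makes every row of the trace `g` parallel to `ν`, so only the part of the traction acting through
the orthogonal projection `ν ⊗ ν` is seen there.

Green's formula rests on the divergence theorem, proved here for the two-dimensional Hausdorff
measure. Locally the domain is a subgraph (`exists_isGraphChart`); the area formula for graphs
(`comap_graphMap`) compares the graph map with a linear map at small scale; a vertical shear then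
flattens the boundary (`integral_subgraph_fderiv`), and a partition of unity globalizes. The case of
`H¹` follows by passing to the limit along the sequence that defines the trace.

The Euler–Lagrange conditions come from bump functions times suitable fields. In the interior and
off the closure of `Γ` constant fields suffice. On `Γ` the field must satisfy the tangential
constraint and be `C¹` in space: `a ⊗ ∇ρ`, with `ρ` a local `C²` defining function, does both
(`vdot_traction_eq_zero`). Surface measure charges every neighbourhood of a boundary point, so the
conditions hold pointwise. -/

/-- The Euclidean plane. -/
abbrev Vec2 := EuclideanSpace ℝ (Fin 2)

/-! ### Comparison of measures and of Hausdorff measures -/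

/-- Second countability reduces the neighbourhoods to a countable cover; after making it disjoint,
countable additivity sums the local inequalities without loss in the constant. -/
theorem measure_le_mul_of_locally {X : Type*} [TopologicalSpace X] [SecondCountableTopology X]
    [MeasurableSpace X] [OpensMeasurableSpace X] {μ ν : Measure X} {K : ℝ≥0∞}
    (h : ∀ x, ∃ U ∈ 𝓝 x, ∀ A ⊆ U, MeasurableSet A → μ A ≤ K * ν A)
    {A : Set X} (hA : MeasurableSet A) : μ A ≤ K * ν A := by
  choose U hU hμ using h
  obtain ⟨s, hs, hcov⟩ := TopologicalSpace.countable_cover_nhds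
    (fun x => interior_mem_nhds.2 (hU x))
  rcases s.eq_empty_or_nonempty with rfl | hne
  · have : A = ∅ := by
      rw [Set.eq_empty_iff_forall_notMem]
      intro x _
      have : x ∈ (Set.univ : Set X) := trivial
      rw [← hcov] at this
      simp at this
    simp [this]
  obtain ⟨e, rfl⟩ := hs.exists_eq_range hne
  have hcov' : ⋃ n, interior (U (e n)) = Set.univ := by
    rw [← hcov]; simp
  set V : ℕ → Set X := disjointed fun n => interior (U (e n)) with hV
  have hVm : ∀ n, MeasurableSet (V n) :=
    MeasurableSet.disjointed fun n => isOpen_interior.measurableSet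
  have hVd : Pairwise (Function.onFun Disjoint V) := disjoint_disjointed _
  have hAu : A = ⋃ n, A ∩ V n := by
    rw [← Set.inter_iUnion, hV, iUnion_disjointed, hcov', Set.inter_univ]
  have hd : Pairwise (Function.onFun Disjoint fun n => A ∩ V n) := fun i j hij =>
    (hVd hij).mono Set.inter_subset_right Set.inter_subset_right
  rw [hAu, measure_iUnion hd fun n => hA.inter (hVm n),
    measure_iUnion hd fun n => hA.inter (hVm n), ← ENNReal.tsum_mul_left]
  refine ENNReal.tsum_le_tsum fun n => hμ (e n) _ ?_ (hA.inter (hVm n))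
  exact (Set.inter_subset_right.trans (disjointed_subset _ n)).trans interior_subset

/-- Globalize at fixed `K`, then let `K` decrease to `1`. The limit is only needed where `ν A` is
finite. -/
theorem measure_le_of_locally_le_pow {X : Type*} [TopologicalSpace X] [SecondCountableTopology X]
    [MeasurableSpace X] [OpensMeasurableSpace X] {μ ν : Measure X} (n : ℕ)
    (h : ∀ K : ℝ≥0, 1 < K → ∀ x, ∃ U ∈ 𝓝 x, ∀ A ⊆ U, MeasurableSet A → μ A ≤ (K : ℝ≥0∞) ^ n * ν A) :
    μ ≤ ν := by
  refine Measure.le_iff.2 fun A hA => ?_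
  have key : ∀ K : ℝ≥0, 1 < K → μ A ≤ ((K ^ n : ℝ≥0) : ℝ≥0∞) * ν A := fun K hK => by
    rw [ENNReal.coe_pow]
    exact measure_le_mul_of_locally (h K hK) hA
  by_cases htop : ν A = ∞
  · simp [htop]
  have hlim : Tendsto (fun K : ℝ≥0 => ((K ^ n : ℝ≥0) : ℝ≥0∞) * ν A) (𝓝[>] 1) (𝓝 (1 * ν A)) := by
    refine ENNReal.Tendsto.mul_const ?_ (Or.inr htop)
    have : Tendsto (fun K : ℝ≥0 => K ^ n) (𝓝[>] 1) (𝓝 1) := by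
      have h1 : Continuous fun K : ℝ≥0 => K ^ n := by fun_prop
      simpa using (h1.tendsto 1).mono_left nhdsWithin_le_nhds
    exact_mod_cast (ENNReal.continuous_coe.tendsto 1).comp this
  rw [one_mul] at hlim
  exact ge_of_tendsto hlim (eventually_nhdsWithin_of_forall fun K hK => key K hK)

/-- The estimate says that `g x ↦ f x` is a well-defined `K`-Lipschitz map on `g '' A`, even if `g`
is not injective. The normalizing constant is common to both Hausdorff measures. -/
theorem euclideanHausdorffMeasure_image_le_of_edist_le {X Y Z : Type*} [EMetricSpace Y]
    [MeasurableSpace Y] [BorelSpace Y] [EMetricSpace Z] [MeasurableSpace Z] [BorelSpace Z]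
    {f : X → Y} {g : X → Z} {A : Set X} {K : ℝ≥0}
    (h : ∀ x ∈ A, ∀ y ∈ A, edist (f x) (f y) ≤ K * edist (g x) (g y)) (d : ℕ) :
    (Measure.euclideanHausdorffMeasure d : Measure Y) (f '' A) ≤
      (K : ℝ≥0∞) ^ d * (Measure.euclideanHausdorffMeasure d : Measure Z) (g '' A) := by
  classical
  rcases A.eq_empty_or_nonempty with rfl | ⟨a, ha⟩
  · simp
  -- A section of `g`, with default value `a` off the image so that it always lands in `A`.
  have hex : ∀ z, ∃ x, x ∈ A ∧ (z ∈ g '' A → g x = z) := fun z => by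
    by_cases hz : z ∈ g '' A
    · obtain ⟨x, hx, rfl⟩ := hz
      exact ⟨x, hx, fun _ => rfl⟩
    · exact ⟨a, ha, fun h => absurd h hz⟩
  choose s hs hgs using hex
  have hL : LipschitzOnWith K (fun z => f (s z)) (g '' A) := fun z hz w hw => by
    simpa only [hgs z hz, hgs w hw] using h _ (hs z) _ (hs w)
  have himg : f '' A = (fun z => f (s z)) '' (g '' A) := by
    rw [Set.image_image]
    refine Set.image_congr fun x hx => ?_
    have := h x hx _ (hs (g x))
    rw [hgs _ (Set.mem_image_of_mem g hx), edist_self, mul_zero] at this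
    exact edist_le_zero.1 this
  have := hL.hausdorffMeasure_image_le (d := (d : ℝ)) (by positivity)
  rw [← himg, ENNReal.rpow_natCast] at this
  rw [Measure.euclideanHausdorffMeasure_def, Measure.euclideanHausdorffMeasure_def,
    Measure.smul_apply, Measure.smul_apply, ENNReal.smul_def, ENNReal.smul_def, smul_eq_mul,
    smul_eq_mul, mul_left_comm]
  gcongr

/-! ### Orthonormal frames -/

/-- `T` identifies the orthogonal sum of the plane and a line with three-space. -/
def IsFrame (T : (Vec2 × ℝ) ≃L[ℝ] Vec3) : Prop :=
  ∀ p q, inner ℝ (T p) (T q) = inner ℝ p.1 q.1 + p.2 * q.2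

theorem IsFrame.norm_sq {T : (Vec2 × ℝ) ≃L[ℝ] Vec3} (hT : IsFrame T) (p : Vec2 × ℝ) :
    ‖T p‖ ^ 2 = ‖p.1‖ ^ 2 + p.2 ^ 2 := by
  rw [← real_inner_self_eq_norm_sq, hT, real_inner_self_eq_norm_sq, sq p.2]

/-- Any linear isometry from the `L²` product sends the vertical unit vector to some unit vector
`u`; the reflection in the hyperplane orthogonal to `u - e` then carries `u` to `e`. -/
theorem exists_isFrame {e : Vec3} (he : ‖e‖ = 1) :
    ∃ T : (Vec2 × ℝ) ≃L[ℝ] Vec3, IsFrame T ∧ T (0, 1) = e := by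
  have hfr : Module.finrank ℝ (WithLp 2 (Vec2 × ℝ)) = Module.finrank ℝ Vec3 := by
    rw [(WithLp.linearEquiv 2 ℝ (Vec2 × ℝ)).finrank_eq]
    simp
  let A : WithLp 2 (Vec2 × ℝ) ≃ₗᵢ[ℝ] Vec3 :=
    (stdOrthonormalBasis ℝ (WithLp 2 (Vec2 × ℝ))).equiv (stdOrthonormalBasis ℝ Vec3) (finCongr hfr)
  let u : Vec3 := A (WithLp.toLp 2 (0, 1))
  have hu : ‖u‖ = ‖e‖ := by
    rw [he, A.norm_map, WithLp.prod_norm_eq_of_L2]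
    simp
  let B : WithLp 2 (Vec2 × ℝ) ≃ₗᵢ[ℝ] Vec3 := A.trans (ℝ ∙ (u - e))ᗮ.reflection
  refine ⟨(WithLp.prodContinuousLinearEquiv 2 ℝ Vec2 ℝ).symm.trans B.toContinuousLinearEquiv,
    fun p q => ?_, ?_⟩
  · change inner ℝ (B (WithLp.toLp 2 p)) (B (WithLp.toLp 2 q)) = _
    rw [B.inner_map_map, WithLp.prod_inner_apply]
    simp [mul_comm]
  · exact Submodule.reflection_sub hu

theorem IsFrame.measurePreserving {T : (Vec2 × ℝ) ≃L[ℝ] Vec3} (hT : IsFrame T) :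
    MeasurePreserving T volume volume := by
  let B : WithLp 2 (Vec2 × ℝ) ≃ₗᵢ[ℝ] Vec3 :=
    ((WithLp.linearEquiv 2 ℝ (Vec2 × ℝ)).trans T.toLinearEquiv).isometryOfInner fun x y => by
      change inner ℝ (T x.ofLp) (T y.ofLp) = _
      rw [hT, WithLp.prod_inner_apply]
      simp [mul_comm]
  exact B.measurePreserving.comp (WithLp.volume_preserving_toLp Vec2 ℝ)

/-! ### Surface area of graphs -/

/-- Parametrization of the graph of `ψ` in the frame `T`. -/
def graphMap (T : (Vec2 × ℝ) ≃L[ℝ] Vec3) (ψ : Vec2 → ℝ) (y : Vec2) : Vec3 := T (y, ψ y)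

/-- The area density of a graph. -/
def areaDensity (ψ : Vec2 → ℝ) (y : Vec2) : ℝ := √(1 + ‖gradient ψ y‖ ^ 2)

theorem continuous_gradient {F : Type*} [NormedAddCommGroup F] [InnerProductSpace ℝ F]
    [CompleteSpace F] {f : F → ℝ} (hf : ContDiff ℝ 1 f) : Continuous (gradient f) :=
  (InnerProductSpace.toDual ℝ F).symm.continuous.comp (hf.continuous_fderiv one_ne_zero)

theorem continuous_areaDensity {ψ : Vec2 → ℝ} (hψ : ContDiff ℝ 1 ψ) :
    Continuous (areaDensity ψ) := by
  have := continuous_gradient hψ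
  unfold areaDensity
  fun_prop

theorem one_le_areaDensity (ψ : Vec2 → ℝ) (y : Vec2) : 1 ≤ areaDensity ψ y :=
  Real.one_le_sqrt.2 (by nlinarith [sq_nonneg ‖gradient ψ y‖])

theorem measurableEmbedding_graphMap (T : (Vec2 × ℝ) ≃L[ℝ] Vec3) {ψ : Vec2 → ℝ}
    (hψ : Continuous ψ) : MeasurableEmbedding (graphMap T ψ) := by
  have hc : Continuous (graphMap T ψ) := by unfold graphMap; fun_prop
  refine Topology.IsClosedEmbedding.measurableEmbedding ?_
  refine (Function.LeftInverse.isClosedEmbedding (f := fun x => (T.symm x).1) ?_ ?_ hc)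
  · intro y; simp [graphMap]
  · fun_prop

/-- A symmetric linear map of the plane with `|S h|² = |h|² + ⟨w, h⟩²`. -/
theorem exists_linearMap_norm_sq (w : Vec2) :
    ∃ S : Vec2 →ₗ[ℝ] Vec2, (∀ h, ‖S h‖ ^ 2 = ‖h‖ ^ 2 + inner ℝ w h ^ 2) ∧
      LinearMap.det S = √(1 + ‖w‖ ^ 2) := by
  set r := √(1 + ‖w‖ ^ 2) with hr
  have hr2 : r ^ 2 = 1 + ‖w‖ ^ 2 := Real.sq_sqrt (by positivity)
  have hr0 : 0 ≤ r := Real.sqrt_nonneg _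
  have hc : (1 + r) ≠ 0 := by positivity
  -- This is the square root of `1 + w wᵀ`: with `c = (1 + r)⁻¹` and `‖w‖² = r² - 1` one has `2c +
  -- c²‖w‖² = 1`, and the determinant is `1 + c‖w‖² = r`.
  refine ⟨LinearMap.transvection (innerₛₗ ℝ w) ((1 + r)⁻¹ • w), fun h => ?_, ?_⟩
  · rw [LinearMap.transvection.apply, ← real_inner_self_eq_norm_sq, inner_add_add_self]
    simp only [inner_smul_left, inner_smul_right, real_inner_self_eq_norm_sq, innerₛₗ_apply_apply,
      real_inner_comm w h]
    have : ‖w‖ ^ 2 = r ^ 2 - 1 := by linarith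
    rw [this]
    simp
    field_simp
    ring
  · rw [LinearMap.transvection.det]
    simp only [innerₛₗ_apply_apply, inner_smul_right, real_inner_self_eq_norm_sq]
    have : ‖w‖ ^ 2 = r ^ 2 - 1 := by linarith
    rw [this]
    field_simp
    ring

/-- The derivative of the graph map at `y₀` has the same norms as `S`, and `S` does not shrink
vectors, so the error from strict differentiability is a small fraction of `‖S (x - y)‖`. -/
theorem graphMap_locally_biLipschitz {T : (Vec2 × ℝ) ≃L[ℝ] Vec3} (hT : IsFrame T) {ψ : Vec2 → ℝ}
    (hψ : ContDiff ℝ 1 ψ) (y₀ : Vec2) {S : Vec2 →ₗ[ℝ] Vec2}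
    (hS : ∀ h, ‖S h‖ ^ 2 = ‖h‖ ^ 2 + inner ℝ (gradient ψ y₀) h ^ 2) {K : ℝ≥0} (hK : 1 < K) :
    ∃ U ∈ 𝓝 y₀, ∀ x ∈ U, ∀ y ∈ U,
      edist (graphMap T ψ x) (graphMap T ψ y) ≤ K * edist (S x) (S y) ∧
      edist (S x) (S y) ≤ K * edist (graphMap T ψ x) (graphMap T ψ y) := by
  have hK' : (1 : ℝ) < K := by exact_mod_cast hK
  let M : Vec2 →L[ℝ] Vec3 :=
    (T : (Vec2 × ℝ) →L[ℝ] Vec3) ∘L (ContinuousLinearMap.id ℝ Vec2).prod (fderiv ℝ ψ y₀)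
  have hM : HasStrictFDerivAt (graphMap T ψ) M y₀ :=
    T.hasStrictFDerivAt.comp y₀
      ((hasStrictFDerivAt_id y₀).prodMk (hψ.hasStrictFDerivAt one_ne_zero))
  have hMS : ∀ h, ‖M h‖ = ‖S h‖ := fun h => by
    rw [← sq_eq_sq₀ (norm_nonneg _) (norm_nonneg _), hS, inner_gradient_left]
    exact hT.norm_sq (h, fderiv ℝ ψ y₀ h)
  have hSh : ∀ h, ‖h‖ ≤ ‖S h‖ := fun h => by
    rw [← sq_le_sq₀ (norm_nonneg _) (norm_nonneg _), hS]
    nlinarith [sq_nonneg (inner ℝ (gradient ψ y₀) h)]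
  have hδ : 0 < 1 - (K : ℝ)⁻¹ := by
    have := inv_lt_one_of_one_lt₀ hK'
    linarith
  have hev := (hasStrictFDerivAt_iff_isLittleO.1 hM).bound hδ
  rw [nhds_prod_eq] at hev
  obtain ⟨U, hU, hUb⟩ := eventually_prod_self_iff (r := fun x y : Vec2 =>
    ‖graphMap T ψ x - graphMap T ψ y - M (x - y)‖ ≤ (1 - (K : ℝ)⁻¹) * ‖x - y‖) |>.1 hev
  refine ⟨U, hU, fun x hx y hy => ?_⟩
  have h1 := hUb x hx y hy
  have h2 : ‖S (x - y)‖ = dist (S x) (S y) := by rw [dist_eq_norm, map_sub]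
  have h3 := hSh (x - y)
  have h4 := norm_sub_norm_le (graphMap T ψ x - graphMap T ψ y) (M (x - y))
  have h5 := norm_sub_norm_le (M (x - y)) (graphMap T ψ x - graphMap T ψ y)
  rw [norm_sub_rev (M (x - y))] at h5
  rw [hMS] at h4 h5
  have h6 : (1 - (K : ℝ)⁻¹) * ‖x - y‖ ≤ (1 - (K : ℝ)⁻¹) * ‖S (x - y)‖ := by gcongr
  rw [← dist_eq_norm, h2] at h4 h5
  rw [h2] at h6
  have hd := dist_nonneg (x := S x) (y := S y)
  have hKi : (K : ℝ) * (K : ℝ)⁻¹ = 1 := mul_inv_cancel₀ (by positivity)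
  -- The relative error `1 - K⁻¹` gives the lower factor `K⁻¹` and the upper factor `2 - K⁻¹`, which
  -- is at most `K`.
  have hK2 : 2 ≤ (K : ℝ) + (K : ℝ)⁻¹ := by nlinarith [mul_pos hδ (sub_pos.2 hK')]
  have e1 : dist (graphMap T ψ x) (graphMap T ψ y) ≤ K * dist (S x) (S y) := by
    nlinarith
  have e2 : dist (S x) (S y) ≤ K * dist (graphMap T ψ x) (graphMap T ψ y) := by
    have : (K : ℝ)⁻¹ * dist (S x) (S y) ≤ dist (graphMap T ψ x) (graphMap T ψ y) := by nlinarith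
    calc dist (S x) (S y) = K * ((K : ℝ)⁻¹ * dist (S x) (S y)) := by rw [← mul_assoc, hKi, one_mul]
      _ ≤ _ := by gcongr
  constructor
  · rw [edist_nndist, edist_nndist]
    exact_mod_cast (by exact_mod_cast e1 :
      nndist (graphMap T ψ x) (graphMap T ψ y) ≤ K * nndist (S x) (S y))
  · rw [edist_nndist, edist_nndist]
    exact_mod_cast (by exact_mod_cast e2 :
      nndist (S x) (S y) ≤ K * nndist (graphMap T ψ x) (graphMap T ψ y))

/-- Near `y₀` the graph over `A` has the measure of `S '' A`, which is `det S` times the area of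
`A`, up to a factor `K ^ 2`; freezing the continuous density at `y₀` costs one more `K`. Hence the
exponent `3`. -/
theorem comap_graphMap {T : (Vec2 × ℝ) ≃L[ℝ] Vec3} (hT : IsFrame T) {ψ : Vec2 → ℝ}
    (hψ : ContDiff ℝ 1 ψ) :
    (Measure.euclideanHausdorffMeasure 2 : Measure Vec3).comap (graphMap T ψ) =
      volume.withDensity (fun y => ENNReal.ofReal (areaDensity ψ y)) := by
  have hemb := measurableEmbedding_graphMap T hψ.continuous
  have hJc := continuous_areaDensity hψ
  have key : ∀ K : ℝ≥0, 1 < K → ∀ y₀, ∃ U ∈ 𝓝 y₀, ∀ A ⊆ U, MeasurableSet A →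
      (Measure.euclideanHausdorffMeasure 2 : Measure Vec3).comap (graphMap T ψ) A ≤
        (K : ℝ≥0∞) ^ 3 * volume.withDensity (fun y => ENNReal.ofReal (areaDensity ψ y)) A ∧
      volume.withDensity (fun y => ENNReal.ofReal (areaDensity ψ y)) A ≤ (K : ℝ≥0∞) ^ 3 *
        (Measure.euclideanHausdorffMeasure 2 : Measure Vec3).comap (graphMap T ψ) A := by
    intro K hK y₀
    have hK' : (1 : ℝ) < K := by exact_mod_cast hK
    obtain ⟨S, hS, hdet⟩ := exists_linearMap_norm_sq (gradient ψ y₀)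
    obtain ⟨U, hU, hUb⟩ := graphMap_locally_biLipschitz hT hψ y₀ hS hK
    have hJ0 : 0 < areaDensity ψ y₀ := lt_of_lt_of_le one_pos (one_le_areaDensity ψ y₀)
    have hV1 : ∀ᶠ y in 𝓝 y₀, areaDensity ψ y < K * areaDensity ψ y₀ :=
      hJc.continuousAt.eventually_lt_const (by nlinarith)
    have hV2 : ∀ᶠ y in 𝓝 y₀, areaDensity ψ y₀ < K * areaDensity ψ y :=
      (continuousAt_const.mul hJc.continuousAt).eventually_const_lt
        (lt_mul_of_one_lt_left hJ0 hK')
    refine ⟨_, inter_mem hU (hV1.and hV2), fun A hA hAm => ?_⟩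
    rw [hemb.comap_apply, withDensity_apply _ hAm]
    have hvol : (Measure.euclideanHausdorffMeasure 2 : Measure Vec2) (S '' A) =
        ENNReal.ofReal (areaDensity ψ y₀) * volume A := by
      rw [EuclideanSpace.euclideanHausdorffMeasure_eq_volume, Measure.addHaar_image_linearMap, hdet,
        abs_of_nonneg (Real.sqrt_nonneg _)]
      rfl
    have hKr : ∀ r : ℝ, ENNReal.ofReal (K * r) = K * ENNReal.ofReal r := fun r => by
      rw [ENNReal.ofReal_mul (by positivity), ENNReal.ofReal_coe_nnreal]
    have i1 : ENNReal.ofReal (areaDensity ψ y₀) * volume A ≤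
        K * ∫⁻ y in A, ENNReal.ofReal (areaDensity ψ y) := by
      rw [← lintegral_const_mul' _ _ ENNReal.coe_ne_top, ← setLIntegral_const]
      refine setLIntegral_mono' hAm fun y hy => ?_
      rw [← hKr]
      exact ENNReal.ofReal_le_ofReal (hA hy).2.2.le
    have i2 : ∫⁻ y in A, ENNReal.ofReal (areaDensity ψ y) ≤
        K * (ENNReal.ofReal (areaDensity ψ y₀) * volume A) := by
      rw [← mul_assoc, ← hKr, ← setLIntegral_const]
      refine setLIntegral_mono' hAm fun y hy => ?_
      exact ENNReal.ofReal_le_ofReal (hA hy).2.1.le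
    have i3 := euclideanHausdorffMeasure_image_le_of_edist_le (f := graphMap T ψ) (g := S) (A := A)
      (K := K) (fun x hx y hy => (hUb x (hA hx).1 y (hA hy).1).1) 2
    have i4 := euclideanHausdorffMeasure_image_le_of_edist_le (f := S) (g := graphMap T ψ) (A := A)
      (K := K) (fun x hx y hy => (hUb x (hA hx).1 y (hA hy).1).2) 2
    rw [hvol] at i3 i4
    constructor
    · refine i3.trans ?_
      rw [pow_succ (K : ℝ≥0∞) 2, mul_assoc]
      gcongr
    · refine i2.trans ?_
      rw [pow_succ' (K : ℝ≥0∞) 2, mul_assoc]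
      gcongr
  refine le_antisymm (measure_le_of_locally_le_pow 3 fun K hK y => ?_)
    (measure_le_of_locally_le_pow 3 fun K hK y => ?_)
  · obtain ⟨U, hU, h⟩ := key K hK y
    exact ⟨U, hU, fun A hA hAm => (h A hA hAm).1⟩
  · obtain ⟨U, hU, h⟩ := key K hK y
    exact ⟨U, hU, fun A hA hAm => (h A hA hAm).2⟩

/-- The area formula for graphs. -/
theorem map_graphMap {T : (Vec2 × ℝ) ≃L[ℝ] Vec3} (hT : IsFrame T) {ψ : Vec2 → ℝ}
    (hψ : ContDiff ℝ 1 ψ) :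
    (volume.withDensity (fun y => ENNReal.ofReal (areaDensity ψ y))).map (graphMap T ψ) =
      (Measure.euclideanHausdorffMeasure 2 : Measure Vec3).restrict (Set.range (graphMap T ψ)) := by
  rw [← comap_graphMap hT hψ, (measurableEmbedding_graphMap T hψ.continuous).map_comap]

/-! ### Defining functions and the outer normal -/

theorem eq_zero_of_mem_frontier {Ω : Set Vec3} (hΩ : IsOpen Ω) {x : Vec3} (hx : x ∈ frontier Ω)
    {ρ : Vec3 → ℝ} (hρ : Continuous ρ) (h : ∀ᶠ y in 𝓝 x, (y ∈ Ω ↔ ρ y < 0)) : ρ x = 0 := by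
  rw [hΩ.frontier_eq] at hx
  have h1 : ¬ρ x < 0 := fun h' => hx.2 (h.self_of_nhds.2 h')
  have h2 : ρ x ≤ 0 := by
    by_contra! h2
    have : ∀ᶠ y in 𝓝 x, 0 < ρ y := hρ.continuousAt.eventually_const_lt h2
    obtain ⟨y, hy, hy1, hy2⟩ := ((mem_closure_iff_frequently.1 hx.1).and_eventually
      (this.and h)).exists
    exact absurd (hy2.1 hy) hy1.not_gt
  linarith

theorem IsDefiningFunctionAt.differentiableAt {Ω : Set Vec3} {x : Vec3} {ρ : Vec3 → ℝ}
    (h : IsDefiningFunctionAt Ω x ρ) (y : Vec3) : DifferentiableAt ℝ ρ y :=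
  h.1.differentiable two_ne_zero y

theorem IsDefiningFunctionAt.eventually {Ω : Set Vec3} {x : Vec3} {ρ : Vec3 → ℝ}
    (h : IsDefiningFunctionAt Ω x ρ) : ∀ᶠ y in 𝓝 x, IsDefiningFunctionAt Ω y ρ := by
  have h1 : ∀ᶠ y in 𝓝 x, gradient ρ y ≠ 0 :=
    (continuous_gradient (h.1.of_le one_le_two)).continuousAt.eventually_ne h.2.1
  filter_upwards [h1, h.2.2.eventually_nhds] with y hy1 hy2
  exact ⟨h.1, hy1, hy2⟩

theorem eventually_lt_of_inner_gradient_neg {ρ : Vec3 → ℝ} {x v : Vec3}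
    (hd : DifferentiableAt ℝ ρ x) (h0 : ρ x = 0) (hv : inner ℝ (gradient ρ x) v < 0) :
    ∀ᶠ t : ℝ in 𝓝[>] 0, ρ (x + t • v) < 0 := by
  have h1 : HasDerivAt (fun t : ℝ => ρ (x + t • v)) (inner ℝ (gradient ρ x) v) 0 := by
    rw [inner_gradient_left]
    have h2 : HasDerivAt (fun t : ℝ => x + t • v) v 0 := by
      simpa using ((hasDerivAt_id (0 : ℝ)).smul_const v).const_add x
    have h3 : HasFDerivAt ρ (fderiv ℝ ρ x) (x + (0 : ℝ) • v) := by simpa using hd.hasFDerivAt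
    exact h3.comp_hasDerivAt (0 : ℝ) h2
  have h4 := hasDerivAt_iff_tendsto_slope.1 h1
  have h5 : ∀ᶠ t in 𝓝[>] (0 : ℝ), slope (fun t : ℝ => ρ (x + t • v)) 0 t < 0 :=
    (h4.eventually_lt_const hv).filter_mono (nhdsWithin_mono _ fun t ht => ne_of_gt ht)
  filter_upwards [h5, self_mem_nhdsWithin] with t ht ht0
  rw [slope_def_field] at ht
  simp only [zero_smul, add_zero, h0, sub_zero] at ht
  by_contra! hcon
  exact absurd ht (div_nonneg hcon (le_of_lt ht0)).not_gt

/-- If the unit gradients `a` and `b` differed, a short step from `x` along `b - a` would decrease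
`ρ₁` and increase `ρ₂`, hence land both inside and outside the domain. This makes the choice in
`outerNormal` harmless. -/
theorem normalized_gradient_eq {Ω : Set Vec3} (hΩ : IsOpen Ω) {x : Vec3} (hx : x ∈ frontier Ω)
    {ρ₁ ρ₂ : Vec3 → ℝ} (h₁ : IsDefiningFunctionAt Ω x ρ₁) (h₂ : IsDefiningFunctionAt Ω x ρ₂) :
    ‖gradient ρ₁ x‖⁻¹ • gradient ρ₁ x = ‖gradient ρ₂ x‖⁻¹ • gradient ρ₂ x := by
  set a := ‖gradient ρ₁ x‖⁻¹ • gradient ρ₁ x with ha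
  set b := ‖gradient ρ₂ x‖⁻¹ • gradient ρ₂ x with hb
  have hga : gradient ρ₁ x = ‖gradient ρ₁ x‖ • a := by
    rw [ha, smul_inv_smul₀ (norm_ne_zero_iff.2 h₁.2.1)]
  have hgb : gradient ρ₂ x = ‖gradient ρ₂ x‖ • b := by
    rw [hb, smul_inv_smul₀ (norm_ne_zero_iff.2 h₂.2.1)]
  have hna : ‖a‖ = 1 := norm_smul_inv_norm (𝕜 := ℝ) h₁.2.1
  have hnb : ‖b‖ = 1 := norm_smul_inv_norm (𝕜 := ℝ) h₂.2.1
  by_contra hab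
  have hlt : inner ℝ a b < 1 := by
    exact (inner_lt_one_iff_real_of_norm_eq_one hna hnb).2 hab
  have hpa : 0 < ‖gradient ρ₁ x‖ := norm_pos_iff.2 h₁.2.1
  have hpb : 0 < ‖gradient ρ₂ x‖ := norm_pos_iff.2 h₂.2.1
  have e1 : ∀ᶠ t : ℝ in 𝓝[>] 0, ρ₁ (x + t • (b - a)) < 0 := by
    refine eventually_lt_of_inner_gradient_neg (h₁.differentiableAt x)
      (eq_zero_of_mem_frontier hΩ hx h₁.1.continuous h₁.2.2) ?_
    rw [hga, inner_smul_left, inner_sub_right, real_inner_self_eq_norm_sq, hna]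
    exact mul_neg_of_pos_of_neg hpa (by simpa using hlt)
  have e2 : ∀ᶠ t : ℝ in 𝓝[>] 0, -ρ₂ (x + t • (b - a)) < 0 := by
    have hneg : gradient (fun y => -ρ₂ y) x = -gradient ρ₂ x := by
      simp [gradient]
    refine eventually_lt_of_inner_gradient_neg (ρ := fun y => -ρ₂ y)
      (h₂.differentiableAt x).neg
      (by simp [eq_zero_of_mem_frontier hΩ hx h₂.1.continuous h₂.2.2]) ?_
    rw [hneg, hgb, inner_neg_left, inner_smul_left, inner_sub_right, real_inner_self_eq_norm_sq,
      hnb, real_inner_comm]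
    simpa using mul_pos hpb (by linarith : 0 < 1 ^ 2 - inner ℝ a b)
  have htend : Tendsto (fun t : ℝ => x + t • (b - a)) (𝓝[>] 0) (𝓝 x) := by
    have : Continuous fun t : ℝ => x + t • (b - a) := by fun_prop
    simpa using (this.tendsto 0).mono_left nhdsWithin_le_nhds
  obtain ⟨t, ht1, ht2, ht3, ht4⟩ := (e1.and (e2.and ((htend.eventually h₁.2.2).and
    (htend.eventually h₂.2.2)))).exists
  have := ht4.1 (ht3.2 ht1)
  linarith

theorem outerNormal_eq {Ω : Set Vec3} (hΩ : IsOpen Ω) {x : Vec3} (hx : x ∈ frontier Ω)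
    {ρ : Vec3 → ℝ} (h : IsDefiningFunctionAt Ω x ρ) :
    outerNormal Ω x = ‖gradient ρ x‖⁻¹ • gradient ρ x := by
  have hex : ∃ ρ, IsDefiningFunctionAt Ω x ρ := ⟨ρ, h⟩
  rw [outerNormal, dif_pos hex]
  exact normalized_gradient_eq hΩ hx hex.choose_spec h

theorem norm_outerNormal {Ω : Set Vec3} (hΩ : IsOpen Ω) (hΩ2 : HasC2Boundary Ω) {x : Vec3}
    (hx : x ∈ frontier Ω) : ‖outerNormal Ω x‖ = 1 := by
  obtain ⟨ρ, hρ⟩ := hΩ2 x hx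
  rw [outerNormal_eq hΩ hx hρ]
  exact norm_smul_inv_norm (𝕜 := ℝ) hρ.2.1

/-- A single `ρ` is a defining function at all nearby boundary points, so locally the normal is one
continuous expression. -/
theorem continuousOn_outerNormal {Ω : Set Vec3} (hΩ : IsOpen Ω) (hΩ2 : HasC2Boundary Ω) :
    ContinuousOn (outerNormal Ω) (frontier Ω) := by
  intro x hx
  obtain ⟨ρ, hρ⟩ := hΩ2 x hx
  have hg := (continuous_gradient (hρ.1.of_le one_le_two)).continuousAt (x := x)
  have hc : ContinuousAt (fun y => ‖gradient ρ y‖⁻¹ • gradient ρ y) x :=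
    (hg.norm.inv₀ (norm_ne_zero_iff.2 hρ.2.1)).smul hg
  refine hc.continuousWithinAt.congr_of_eventuallyEq ?_ (outerNormal_eq hΩ hx hρ)
  filter_upwards [self_mem_nhdsWithin, nhdsWithin_le_nhds hρ.eventually] with y hy hy'
  exact outerNormal_eq hΩ hy hy'

/-! ### Graph charts of the boundary -/

/-- In the open set `U`, the domain is the subgraph of `ψ` in the frame `T`, and its boundary is the
graph. -/
structure IsGraphChart (Ω : Set Vec3) (T : (Vec2 × ℝ) ≃L[ℝ] Vec3) (ψ : Vec2 → ℝ) (U : Set Vec3) :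
    Prop where
  isFrame : IsFrame T
  contDiff : ContDiff ℝ 2 ψ
  isOpen : IsOpen U
  mem_iff : ∀ x ∈ U, x ∈ Ω ↔ (T.symm x).2 < ψ (T.symm x).1
  mem_frontier_iff : ∀ x ∈ U, x ∈ frontier Ω ↔ (T.symm x).2 = ψ (T.symm x).1

/-- Cutting off by a bump function turns the implicit function, smooth only near one point, into the
global `ψ` that a chart requires. -/
theorem exists_contDiff_eventuallyEq {f : Vec2 → ℝ} {y : Vec2} (hf : ContDiffAt ℝ 2 f y) :
    ∃ g : Vec2 → ℝ, ContDiff ℝ 2 g ∧ g =ᶠ[𝓝 y] f := by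
  obtain ⟨R, hR, hball⟩ := Metric.eventually_nhds_iff_ball.1 (hf.eventually (by decide))
  let χ : ContDiffBump y := ⟨R / 4, R / 2, by positivity, by linarith⟩
  refine ⟨fun z => χ z * f z, ?_, ?_⟩
  · rw [contDiff_iff_contDiffAt]
    intro z
    by_cases hz : z ∈ Metric.ball y R
    · exact (χ.contDiff (n := 2)).contDiffAt.mul (hball z hz)
    · have hz' : z ∉ tsupport χ := by
        rw [χ.tsupport_eq]
        intro h
        rw [Metric.mem_closedBall] at h
        rw [Metric.mem_ball] at hz
        have : χ.rOut = R / 2 := rfl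
        linarith
      refine (contDiffAt_const (c := (0 : ℝ))).congr_of_eventuallyEq ?_
      filter_upwards [notMem_tsupport_iff_eventuallyEq.1 hz'] with w hw
      simp [hw]
  · filter_upwards [χ.eventuallyEq_one] with z hz
    simp [hz]

/-- With the vertical axis along `∇ρ x₀`, the implicit function theorem solves `ρ = 0` for the
height. As `ρ` increases strictly with height in a small box, its sign is the sign of height minus
`ψ`. -/
theorem exists_isGraphChart {Ω : Set Vec3} (hΩ : IsOpen Ω) (hΩ2 : HasC2Boundary Ω) {x₀ : Vec3}
    (hx₀ : x₀ ∈ frontier Ω) : ∃ T ψ U, x₀ ∈ U ∧ IsGraphChart Ω T ψ U := by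
  obtain ⟨ρ, hρ⟩ := hΩ2 x₀ hx₀
  set n := gradient ρ x₀ with hn
  have hn0 : 0 < ‖n‖ := norm_pos_iff.2 hρ.2.1
  obtain ⟨T, hT, hTe⟩ := exists_isFrame (norm_smul_inv_norm (𝕜 := ℝ) hρ.2.1)
  set u := T.symm x₀ with hu
  have hTu : T u = x₀ := T.apply_symm_apply x₀
  let h : Vec2 × ℝ → ℝ := fun p => ρ (T p)
  have hh : ContDiff ℝ 2 h := hρ.1.comp T.contDiff
  have hhd : ∀ p, fderiv ℝ h p (0, 1) = fderiv ℝ ρ (T p) (T (0, 1)) := fun p => by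
    have := ((hρ.differentiableAt (T p)).hasFDerivAt.comp p T.hasFDerivAt).fderiv
    change fderiv ℝ h p = _ at this
    rw [this]
    rfl
  have hpos : 0 < fderiv ℝ h u (0, 1) := by
    rw [hhd, hTu, hTe, ← inner_gradient_left, inner_smul_right, real_inner_self_eq_norm_sq]
    change 0 < ‖n‖⁻¹ * ‖n‖ ^ 2
    positivity
  have hinv : (fderiv ℝ h u ∘L .inr ℝ Vec2 ℝ).IsInvertible := by
    let E := ContinuousLinearEquiv.unitsEquivAut ℝ (Units.mk0 _ hpos.ne')
    refine ⟨E, ?_⟩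
    ext
    simp [E]
  have hcd : ContDiffAt ℝ 2 h u := hh.contDiffAt
  have hh0 : h u = 0 := by
    change ρ (T u) = 0
    rw [hTu]
    exact eq_zero_of_mem_frontier hΩ hx₀ hρ.1.continuous hρ.2.2
  obtain ⟨ψ, hψ, hψe⟩ := exists_contDiff_eventuallyEq
    (hcd.contDiffAt_implicitFunction two_ne_zero hinv)
  have hψu : ψ u.1 = u.2 := by
    rw [hψe.self_of_nhds, hcd.implicitFunction_apply_self]
  have hψ0 : ∀ᶠ y in 𝓝 u.1, h (y, ψ y) = 0 := by
    filter_upwards [hψe, hcd.eventually_apply_implicitFunction two_ne_zero hinv] with y h1 h2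
    rw [h1, h2, hh0]
  have hdpos : ∀ᶠ p in 𝓝 u, 0 < fderiv ℝ h p (0, 1) := by
    have : Continuous fun p => fderiv ℝ h p (0, 1) :=
      (hh.continuous_fderiv two_ne_zero).clm_apply continuous_const
    exact this.continuousAt.eventually_const_lt hpos
  obtain ⟨δ, hδ, hbox⟩ := Metric.eventually_nhds_iff_ball.1 hdpos
  have hψδ : ∀ᶠ y in 𝓝 u.1, ψ y ∈ Metric.ball u.2 δ := by
    refine hψ.continuous.continuousAt.eventually_mem ?_
    rw [hψu]
    exact Metric.ball_mem_nhds _ hδ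
  -- Base points over which `ψ` solves the equation and its graph stays in the box of monotonicity.
  let V : Set Vec2 := interior
    {y | h (y, ψ y) = 0 ∧ ψ y ∈ Metric.ball u.2 δ ∧ y ∈ Metric.ball u.1 δ}
  have hV : u.1 ∈ V :=
    mem_interior_iff_mem_nhds.2 (hψ0.and (hψδ.and (Metric.ball_mem_nhds _ hδ)))
  have hmono : ∀ y ∈ V, StrictMonoOn (fun s => h (y, s)) (Metric.ball u.2 δ) := by
    intro y hy
    have hd : ∀ s, HasDerivAt (fun s => h (y, s)) (fderiv ℝ h (y, s) (0, 1)) s := fun s =>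
      (hh.differentiable two_ne_zero (y, s)).hasFDerivAt.comp_hasDerivAt s
        ((hasDerivAt_const s y).prodMk (hasDerivAt_id s))
    refine strictMonoOn_of_deriv_pos (convex_ball _ _)
      (fun s _ => (hd s).continuousAt.continuousWithinAt) fun s hs => ?_
    rw [(hd s).deriv]
    refine hbox _ ?_
    rw [← ball_prod_same]
    exact ⟨(interior_subset hy).2.2, interior_subset hs⟩
  let N : Set Vec3 := interior {y | y ∈ Ω ↔ ρ y < 0}
  have hNiff : ∀ y ∈ N, y ∈ Ω ↔ ρ y < 0 := fun y hy =>
    interior_subset (s := {y | y ∈ Ω ↔ ρ y < 0}) hy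
  refine ⟨T, ψ, T.symm ⁻¹' (V ×ˢ Metric.ball u.2 δ) ∩ N, ⟨⟨hV, Metric.mem_ball_self hδ⟩,
    mem_interior_iff_mem_nhds.2 hρ.2.2⟩, hT, hψ,
    ((isOpen_interior.prod Metric.isOpen_ball).preimage T.symm.continuous).inter isOpen_interior,
    fun x hx => ?_, fun x hx => ?_⟩
  · have hm := hmono _ hx.1.1
    have h0 := (interior_subset hx.1.1).1
    have hlt := hm.lt_iff_lt hx.1.2 (interior_subset hx.1.1).2.1
    rw [← hlt]
    simp only [h0]
    change x ∈ Ω ↔ ρ (T (T.symm x)) < 0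
    rw [T.apply_symm_apply]
    exact hNiff x hx.2
  · have hm := hmono _ hx.1.1
    have h0 := (interior_subset hx.1.1).1
    have heq := hm.injOn.eq_iff hx.1.2 (interior_subset hx.1.1).2.1
    rw [← heq]
    simp only [h0]
    change x ∈ frontier Ω ↔ ρ (T (T.symm x)) = 0
    rw [T.apply_symm_apply]
    constructor
    · exact fun hf => eq_zero_of_mem_frontier hΩ hf hρ.1.continuous
        (mem_interior_iff_mem_nhds.1 hx.2)
    · intro hρ0
      rw [hΩ.frontier_eq]
      refine ⟨?_, fun hxΩ => ?_⟩
      -- A zero of `ρ` is a limit of the points vertically below it, where `ρ` is negative.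
      · set y := (T.symm x).1 with hy
        set t := (T.symm x).2 with ht
        have hTx : T (y, t) = x := T.apply_symm_apply x
        have htend : Tendsto (fun s : ℝ => T (y, s)) (𝓝[<] t) (𝓝 x) := by
          have : Continuous fun s : ℝ => T (y, s) := by fun_prop
          rw [← hTx]
          exact (this.tendsto t).mono_left nhdsWithin_le_nhds
        refine mem_closure_of_tendsto htend ?_
        have hb : ∀ᶠ s in 𝓝[<] t, s ∈ Metric.ball u.2 δ :=
          nhdsWithin_le_nhds (Metric.isOpen_ball.mem_nhds hx.1.2)
        have hN : ∀ᶠ s in 𝓝[<] t, T (y, s) ∈ N :=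
          htend.eventually_mem (isOpen_interior.mem_nhds hx.2)
        filter_upwards [hb, hN, self_mem_nhdsWithin] with s hs hsN hst
        refine (hNiff _ hsN).2 ?_
        have := hm hs hx.1.2 hst
        change ρ (T (y, s)) < ρ (T (y, t)) at this
        rwa [hTx, hρ0] at this
      · have := (hNiff x hx.2).1 hxΩ
        linarith

/-- Height minus `ψ` is itself a defining function; its gradient is the right-hand side, with norm
the area density. In surface integrals the density thus cancels the normalization of the normal. -/
theorem IsGraphChart.outerNormal_graphMap {Ω : Set Vec3} (hΩ : IsOpen Ω)
    {T : (Vec2 × ℝ) ≃L[ℝ] Vec3} {ψ : Vec2 → ℝ} {U : Set Vec3} (h : IsGraphChart Ω T ψ U) {y : Vec2}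
    (hy : graphMap T ψ y ∈ U) :
    areaDensity ψ y • outerNormal Ω (graphMap T ψ y) = T (-gradient ψ y, 1) := by
  set x := graphMap T ψ y with hx
  have hTx : T.symm x = (y, ψ y) := T.symm_apply_apply _
  have hxf : x ∈ frontier Ω := (h.mem_frontier_iff x hy).2 (by rw [hTx])
  let ρ : Vec3 → ℝ := fun z => (T.symm z).2 - ψ (T.symm z).1
  have hρ2 : ContDiff ℝ 2 ρ :=
    (contDiff_snd.comp T.symm.contDiff).sub
      (h.contDiff.comp (contDiff_fst.comp T.symm.contDiff))
  have hgrad : gradient ρ x = T (-gradient ψ y, 1) := by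
    refine HasGradientAt.gradient (hasGradientAt_iff_hasFDerivAt.2 ?_)
    have hd : HasFDerivAt ρ ((ContinuousLinearMap.snd ℝ Vec2 ℝ ∘L (T.symm : Vec3 →L[ℝ] Vec2 × ℝ)) -
        (fderiv ℝ ψ y) ∘L (ContinuousLinearMap.fst ℝ Vec2 ℝ ∘L
          (T.symm : Vec3 →L[ℝ] Vec2 × ℝ))) x := by
      have h1 : HasFDerivAt ψ (fderiv ℝ ψ y) (T.symm x).1 := by
        rw [hTx]
        exact (h.contDiff.differentiable two_ne_zero y).hasFDerivAt
      exact ((hasFDerivAt_snd.comp x T.symm.hasFDerivAt)).sub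
        (h1.comp x (hasFDerivAt_fst.comp x T.symm.hasFDerivAt))
    convert! hd using 1
    refine ContinuousLinearMap.ext fun v => ?_
    obtain ⟨p, rfl⟩ := T.surjective v
    rw [InnerProductSpace.toDual_apply_apply, h.isFrame _ p, inner_neg_left, inner_gradient_left]
    simp
    ring
  have hnorm : ‖gradient ρ x‖ = areaDensity ψ y := by
    rw [areaDensity, hgrad, ← Real.sqrt_sq (norm_nonneg (T _)), h.isFrame.norm_sq]
    simp [add_comm]
  have hJ : areaDensity ψ y ≠ 0 := (lt_of_lt_of_le one_pos (one_le_areaDensity ψ y)).ne'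
  have hdef : IsDefiningFunctionAt Ω x ρ := by
    refine ⟨hρ2, fun h0 => hJ (by rw [← hnorm, h0, norm_zero]), ?_⟩
    filter_upwards [h.isOpen.mem_nhds hy] with z hz
    rw [h.mem_iff z hz, sub_neg]
  rw [outerNormal_eq hΩ hxf hdef, hnorm, smul_inv_smul₀ hJ, hgrad]

/-! ### The surface measure -/

theorem IsGraphChart.surf_restrict {Ω : Set Vec3} {T : (Vec2 × ℝ) ≃L[ℝ] Vec3} {ψ : Vec2 → ℝ}
    {U : Set Vec3} (h : IsGraphChart Ω T ψ U) :
    (surf Ω).restrict U = ((volume.withDensity (fun y => ENNReal.ofReal (areaDensity ψ y))).map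
      (graphMap T ψ)).restrict U := by
  rw [map_graphMap h.isFrame (h.contDiff.of_le one_le_two), surf,
    Measure.restrict_restrict h.isOpen.measurableSet,
    Measure.restrict_restrict h.isOpen.measurableSet]
  congr 1
  ext x
  refine and_congr_right fun hx => ?_
  rw [h.mem_frontier_iff x hx]
  constructor
  · intro hxt
    exact ⟨(T.symm x).1, by rw [graphMap, ← hxt]; exact T.apply_symm_apply x⟩
  · rintro ⟨y, rfl⟩
    simp [graphMap]

theorem surf_restrict_frontier (Ω : Set Vec3) : (surf Ω).restrict (frontier Ω) = surf Ω := by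
  rw [surf, Measure.restrict_restrict isClosed_frontier.measurableSet, Set.inter_self]

theorem ae_surf_mem_frontier (Ω : Set Vec3) : ∀ᵐ x ∂surf Ω, x ∈ frontier Ω :=
  ae_restrict_mem isClosed_frontier.measurableSet

theorem isCompact_frontier {Ω : Set Vec3} (hΩb : Bornology.IsBounded Ω) :
    IsCompact (frontier Ω) :=
  hΩb.isCompact_closure.of_isClosed_subset isClosed_frontier frontier_subset_closure

/-- The boundary is compact, and in a chart surface measure is the image of a measure with
continuous, hence locally integrable, density. -/
theorem isFiniteMeasure_surf {Ω : Set Vec3} (hΩ : IsOpen Ω) (hΩb : Bornology.IsBounded Ω)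
    (hΩ2 : HasC2Boundary Ω) : IsFiniteMeasure (surf Ω) := by
  constructor
  rw [← surf_restrict_frontier, Measure.restrict_apply_univ]
  refine (isCompact_frontier hΩb).measure_lt_top_of_nhdsWithin fun x hx => ?_
  obtain ⟨T, ψ, U, hxU, h⟩ := exists_isGraphChart hΩ hΩ2 hx
  have hloc : IsLocallyFiniteMeasure
      (volume.withDensity (fun y => ENNReal.ofReal (areaDensity ψ y))) :=
    IsLocallyFiniteMeasure.withDensity_ofReal
      (continuous_areaDensity (h.contDiff.of_le one_le_two))
  obtain ⟨V, hV, hVf⟩ := hloc.finiteAtNhds (T.symm x).1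
  have hN : (fun z => (T.symm z).1) ⁻¹' (interior V) ∩ U ∈ 𝓝 x := by
    refine inter_mem ?_ (h.isOpen.mem_nhds hxU)
    have hc : Continuous fun z => (T.symm z).1 := by fun_prop
    exact hc.continuousAt.preimage_mem_nhds (interior_mem_nhds.2 hV)
  refine ⟨_, mem_nhdsWithin_of_mem_nhds hN, ?_⟩
  have hc : Continuous fun z => (T.symm z).1 := by fun_prop
  have hm : MeasurableSet ((fun z => (T.symm z).1) ⁻¹' (interior V)) :=
    (isOpen_interior.preimage hc).measurableSet
  rw [← Measure.restrict_apply hm, h.surf_restrict, Measure.restrict_apply hm]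
  refine (measure_mono Set.inter_subset_left).trans_lt ?_
  rw [(measurableEmbedding_graphMap T h.contDiff.continuous).map_apply]
  refine (measure_mono fun y hy => ?_).trans_lt hVf
  have : (T.symm (graphMap T ψ y)).1 ∈ interior V := hy
  simp only [graphMap, ContinuousLinearEquiv.symm_apply_apply] at this
  exact interior_subset this

/-- The area density is at least `1`, so surface measure dominates plane area in a chart. This is
what yields boundary conditions at every point instead of almost everywhere. -/
theorem surf_pos_of_mem_nhds {Ω : Set Vec3} (hΩ : IsOpen Ω) (hΩ2 : HasC2Boundary Ω) {x : Vec3}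
    (hx : x ∈ frontier Ω) {V : Set Vec3} (hV : V ∈ 𝓝 x) : 0 < surf Ω V := by
  obtain ⟨T, ψ, U, hxU, h⟩ := exists_isGraphChart hΩ hΩ2 hx
  refine lt_of_lt_of_le ?_ (measure_mono (interior_subset.trans' Set.inter_subset_left :
    interior V ∩ U ⊆ V))
  have hm : MeasurableSet (interior V) := isOpen_interior.measurableSet
  have hc : Continuous (graphMap T ψ) := by
    have := h.contDiff.continuous
    unfold graphMap
    fun_prop
  rw [← Measure.restrict_apply hm, h.surf_restrict, Measure.restrict_apply hm,
    (measurableEmbedding_graphMap T h.contDiff.continuous).map_apply]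
  have hopen : IsOpen (graphMap T ψ ⁻¹' (interior V ∩ U)) :=
    (isOpen_interior.inter h.isOpen).preimage hc
  have hne : (graphMap T ψ ⁻¹' (interior V ∩ U)).Nonempty := by
    refine ⟨(T.symm x).1, ?_⟩
    have : graphMap T ψ (T.symm x).1 = x := by
      rw [graphMap, ← (h.mem_frontier_iff x hxU).1 hx]
      exact T.apply_symm_apply x
    rw [Set.mem_preimage, this]
    exact ⟨mem_interior_iff_mem_nhds.2 hV, hxU⟩
  refine lt_of_lt_of_le (hopen.measure_pos volume hne) ?_
  rw [withDensity_apply _ hopen.measurableSet, ← setLIntegral_one]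
  refine lintegral_mono fun y => ?_
  rw [← ENNReal.ofReal_one]
  exact ENNReal.ofReal_le_ofReal (one_le_areaDensity ψ y)

theorem integrable_surf_of_continuousOn {Ω : Set Vec3} (hΩ : IsOpen Ω)
    (hΩb : Bornology.IsBounded Ω) (hΩ2 : HasC2Boundary Ω) {f : Vec3 → ℝ}
    (hf : ContinuousOn f (frontier Ω)) : Integrable f (surf Ω) := by
  have := isFiniteMeasure_surf hΩ hΩb hΩ2
  have h := hf.integrableOn_compact (μ := surf Ω) (isCompact_frontier hΩb)
  rwa [IntegrableOn, surf_restrict_frontier] at h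

/-! ### The divergence theorem below a graph -/

theorem integral_fderiv_eq_zero {E : Type*} [NormedAddCommGroup E] [NormedSpace ℝ E]
    [FiniteDimensional ℝ E] [MeasurableSpace E] [BorelSpace E] (μ : Measure E) [μ.IsAddHaarMeasure]
    {f : E → ℝ} (hf : ContDiff ℝ 1 f) (hfc : HasCompactSupport f) (v : E) :
    ∫ x, fderiv ℝ f x v ∂μ = 0 := by
  have hc : Continuous fun x => fderiv ℝ f x v :=
    (hf.continuous_fderiv one_ne_zero).clm_apply continuous_const
  have hi : Integrable (fun x => fderiv ℝ f x v) μ :=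
    hc.integrable_of_hasCompactSupport (hfc.fderiv_apply ℝ v)
  have h := integral_mul_fderiv_eq_neg_fderiv_mul_of_integrable (μ := μ) (f := fun _ => (1 : ℝ))
    (g := f) (v := v) (by simp) (by simpa using hi)
    (by simpa using hf.continuous.integrable_of_hasCompactSupport hfc)
    (fun x _ => differentiableAt_const _) (fun x _ => hf.differentiable one_ne_zero x)
  simpa using h

/-- Vertical translation by a continuous function. -/
def shear {ψ : Vec2 → ℝ} (hψ : Continuous ψ) : (Vec2 × ℝ) ≃ₜ (Vec2 × ℝ) where
  toFun p := (p.1, p.2 + ψ p.1)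
  invFun p := (p.1, p.2 - ψ p.1)
  left_inv p := by simp
  right_inv p := by simp
  continuous_toFun := by fun_prop
  continuous_invFun := by fun_prop

/-- Shearing by `ψ` flattens the region to a half-space and splits the derivative into a horizontal
part, which integrates to zero on each horizontal plane, and `s - ψ' w` times the vertical part,
which integrates to the boundary value. -/
theorem integral_subgraph_fderiv {ψ : Vec2 → ℝ} (hψ : ContDiff ℝ 1 ψ) {F : Vec2 × ℝ → ℝ}
    (hF : ContDiff ℝ 1 F) (hFc : HasCompactSupport F) (w : Vec2) (s : ℝ) :
    ∫ y, ∫ t in Set.Iic (ψ y), fderiv ℝ F (y, t) (w, s) =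
      ∫ y, F (y, ψ y) * (s - fderiv ℝ ψ y w) := by
  let G : Vec2 × ℝ → ℝ := fun p => F (p.1, p.2 + ψ p.1)
  have hG : ContDiff ℝ 1 G :=
    hF.comp (contDiff_fst.prodMk (contDiff_snd.add (hψ.comp contDiff_fst)))
  have hGc : HasCompactSupport G := hFc.comp_homeomorph (shear hψ.continuous)
  have hGd : ∀ p, DifferentiableAt ℝ G p := hG.differentiable one_ne_zero
  have hGt : ∀ y, ContDiff ℝ 1 fun t => G (y, t) := fun y =>
    hG.comp (contDiff_const.prodMk contDiff_id)
  have hGtc : ∀ y, HasCompactSupport fun t => G (y, t) := fun y =>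
    HasCompactSupport.intro (hGc.isCompact.image continuous_snd) fun t ht => by
      by_contra h0
      exact ht ⟨(y, t), subset_tsupport _ h0, rfl⟩
  have hGy : ∀ t, ContDiff ℝ 1 fun y => G (y, t) := fun t =>
    hG.comp (contDiff_id.prodMk contDiff_const)
  have hGyc : ∀ t, HasCompactSupport fun y => G (y, t) := fun t =>
    HasCompactSupport.intro (hGc.isCompact.image continuous_fst) fun y hy => by
      by_contra h0
      exact hy ⟨(y, t), subset_tsupport _ h0, rfl⟩
  have hderiv : ∀ y t, deriv (fun t => G (y, t)) t = fderiv ℝ G (y, t) (0, 1) := fun y t =>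
    ((hGd (y, t)).hasFDerivAt.comp_hasDerivAt t
      ((hasDerivAt_const t y).prodMk (hasDerivAt_id t))).deriv
  have hpart : ∀ y t, fderiv ℝ (fun y => G (y, t)) y w = fderiv ℝ G (y, t) (w, 0) := fun y t => by
    have hi : HasFDerivAt (fun y : Vec2 => (y, t)) (ContinuousLinearMap.inl ℝ Vec2 ℝ) y :=
      (hasFDerivAt_id y).prodMk (hasFDerivAt_const t y)
    have := ((hGd (y, t)).hasFDerivAt.comp y hi).fderiv
    exact congrArg (fun L => L w) this
  have hchain : ∀ y t, fderiv ℝ F (y, t + ψ y) (w, s) =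
      fderiv ℝ G (y, t) (w, 0) + (s - fderiv ℝ ψ y w) * fderiv ℝ G (y, t) (0, 1) := by
    intro y t
    have hd : HasFDerivAt (fun p : Vec2 × ℝ => (p.1, p.2 + ψ p.1))
        ((ContinuousLinearMap.fst ℝ Vec2 ℝ).prod (ContinuousLinearMap.snd ℝ Vec2 ℝ +
          (fderiv ℝ ψ y) ∘L ContinuousLinearMap.fst ℝ Vec2 ℝ)) (y, t) :=
      hasFDerivAt_fst.prodMk (hasFDerivAt_snd.add
        (HasFDerivAt.comp (y, t) (hψ.differentiable one_ne_zero y).hasFDerivAt hasFDerivAt_fst))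
    have hGf := ((hF.differentiable one_ne_zero (y, t + ψ y)).hasFDerivAt.comp (y, t) hd).fderiv
    change fderiv ℝ G (y, t) = _ at hGf
    rw [hGf]
    simp only [ContinuousLinearMap.comp_apply, ContinuousLinearMap.prod_apply,
      _root_.add_apply, ContinuousLinearMap.coe_fst', ContinuousLinearMap.coe_snd',
      map_zero]
    rw [← smul_eq_mul, ← map_smul, ← map_add]
    simp
  have htrans : ∀ y, ∫ t in Set.Iic (ψ y), fderiv ℝ F (y, t) (w, s) =
      ∫ t in Set.Iic 0, fderiv ℝ F (y, t + ψ y) (w, s) := fun y => by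
    rw [← integral_indicator measurableSet_Iic, ← integral_indicator measurableSet_Iic,
      ← integral_add_right_eq_self _ (ψ y)]
    congr 1
    ext t
    simp only [Set.indicator, Set.mem_Iic, add_le_iff_nonpos_left]
  have hcw : Continuous fun p => fderiv ℝ G p (w, 0) :=
    (hG.continuous_fderiv one_ne_zero).clm_apply continuous_const
  have hct : Continuous fun p => fderiv ℝ G p (0, 1) :=
    (hG.continuous_fderiv one_ne_zero).clm_apply continuous_const
  have hiw : Integrable (fun p => fderiv ℝ G p (w, 0)) :=
    hcw.integrable_of_hasCompactSupport (hGc.fderiv_apply ℝ _)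
  have hcs : ∀ (u : Vec2 × ℝ) (y : Vec2), HasCompactSupport fun t => fderiv ℝ G (y, t) u :=
    fun u y => HasCompactSupport.intro ((hGc.fderiv_apply ℝ u).isCompact.image continuous_snd)
      fun t ht => by
        by_contra h0
        exact ht ⟨(y, t), subset_tsupport _ h0, rfl⟩
  have hinner : ∀ y, ∫ t in Set.Iic (ψ y), fderiv ℝ F (y, t) (w, s) =
      (∫ t in Set.Iic 0, fderiv ℝ G (y, t) (w, 0)) + F (y, ψ y) * (s - fderiv ℝ ψ y w) := by
    intro y
    rw [htrans]
    simp_rw [hchain]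
    have i1 : Integrable fun t => fderiv ℝ G (y, t) (w, 0) :=
      (hcw.comp (by fun_prop : Continuous fun t : ℝ => (y, t))).integrable_of_hasCompactSupport
        (hcs _ y)
    have i2 : Integrable fun t => fderiv ℝ G (y, t) (0, 1) :=
      (hct.comp (by fun_prop : Continuous fun t : ℝ => (y, t))).integrable_of_hasCompactSupport
        (hcs _ y)
    rw [integral_add i1.integrableOn (i2.const_mul _).integrableOn, integral_const_mul]
    simp_rw [← hderiv]
    rw [(hGtc y).integral_Iic_deriv_eq (hGt y) 0]
    simp only [G, zero_add]
    ring
  have hiw' : Integrable (fun p : Vec2 × ℝ => fderiv ℝ G p (w, 0))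
      ((volume : Measure Vec2).prod ((volume : Measure ℝ).restrict (Set.Iic 0))) := by
    have : (volume : Measure Vec2).prod ((volume : Measure ℝ).restrict (Set.Iic 0)) =
        (volume : Measure (Vec2 × ℝ)).restrict (Set.univ ×ˢ Set.Iic 0) := by
      rw [Measure.volume_eq_prod, ← Measure.prod_restrict, Measure.restrict_univ]
    rw [this]
    exact hiw.integrableOn
  simp_rw [hinner]
  rw [integral_add hiw'.integral_prod_left]
  -- With the order exchanged, the inner integral is that of a derivative of a compactly supported
  -- function over the whole plane.
  · rw [integral_integral_swap hiw']
    simp_rw [← hpart]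
    simp_rw [fun t => integral_fderiv_eq_zero volume (hGy t) (hGyc t) w]
    simp
  · refine Continuous.integrable_of_hasCompactSupport ?_ ?_
    · have := (hψ.continuous_fderiv one_ne_zero).clm_apply (continuous_const (y := w))
      have := hψ.continuous
      have := hF.continuous
      fun_prop
    · have := (hGyc 0).mul_right (f' := fun y => s - fderiv ℝ ψ y w)
      simpa [G] using! this

/-! ### The divergence theorem -/

/-- In frame coordinates the two sides become those of `integral_subgraph_fderiv`; outside `U`,
where chart and domain need not agree, `f` vanishes. -/
theorem IsGraphChart.integral_fderiv {Ω : Set Vec3} (hΩ : IsOpen Ω)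
    {T : (Vec2 × ℝ) ≃L[ℝ] Vec3} {ψ : Vec2 → ℝ} {U : Set Vec3} (h : IsGraphChart Ω T ψ U)
    {f : Vec3 → ℝ} (hf : ContDiff ℝ 1 f) (hfc : HasCompactSupport f) (hfU : tsupport f ⊆ U)
    (v : Vec3) :
    ∫ x in Ω, fderiv ℝ f x v = ∫ x, f x * inner ℝ (outerNormal Ω x) v ∂surf Ω := by
  have hψ1 : ContDiff ℝ 1 ψ := h.contDiff.of_le one_le_two
  have hemb := measurableEmbedding_graphMap T h.contDiff.continuous
  have hf0 : ∀ x, x ∉ U → f x = 0 := fun x hx =>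
    image_eq_zero_of_notMem_tsupport fun h' => hx (hfU h')
  obtain ⟨⟨w, s⟩, rfl⟩ := T.surjective v
  have hR : ∫ x, f x * inner ℝ (outerNormal Ω x) (T (w, s)) ∂surf Ω =
      ∫ y, f (T (y, ψ y)) * (s - fderiv ℝ ψ y w) := by
    have hz : ∀ x, x ∉ U → f x * inner ℝ (outerNormal Ω x) (T (w, s)) = 0 := fun x hx => by
      rw [hf0 x hx, zero_mul]
    rw [← setIntegral_eq_integral_of_forall_compl_eq_zero hz, h.surf_restrict,
      setIntegral_eq_integral_of_forall_compl_eq_zero hz, hemb.integral_map,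
      integral_withDensity_eq_integral_toReal_smul
        (continuous_areaDensity hψ1).measurable.ennreal_ofReal (by simp)]
    congr 1
    ext y
    rw [ENNReal.toReal_ofReal (zero_le_one.trans (one_le_areaDensity ψ y)), smul_eq_mul]
    by_cases hy : graphMap T ψ y ∈ U
    · have hn := h.outerNormal_graphMap hΩ hy
      have : areaDensity ψ y * inner ℝ (outerNormal Ω (graphMap T ψ y)) (T (w, s)) =
          s - fderiv ℝ ψ y w := by
        rw [← real_inner_smul_left, hn, h.isFrame, inner_neg_left, inner_gradient_left]
        ring
      rw [mul_left_comm, this]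
      rfl
    · rw [hf0 _ hy]
      have := hf0 _ hy
      rw [graphMap] at this
      rw [this]
      ring
  have hL : ∫ x in Ω, fderiv ℝ f x (T (w, s)) =
      ∫ y, ∫ t in Set.Iic (ψ y), fderiv ℝ (fun p => f (T p)) (y, t) (w, s) := by
    have hcomp : ∀ p, fderiv ℝ (fun p => f (T p)) p (w, s) = fderiv ℝ f (T p) (T (w, s)) := by
      intro p
      have := ((hf.differentiable one_ne_zero (T p)).hasFDerivAt.comp p T.hasFDerivAt).fderiv
      exact congrArg (fun L => L (w, s)) this
    have hmeas : MeasurableSet {p : Vec2 × ℝ | p.2 < ψ p.1} :=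
      (isOpen_lt continuous_snd (h.contDiff.continuous.comp continuous_fst)).measurableSet
    have hind : ∀ p, Ω.indicator (fun x => fderiv ℝ f x (T (w, s))) (T p) =
        {p : Vec2 × ℝ | p.2 < ψ p.1}.indicator
          (fun p => fderiv ℝ (fun p => f (T p)) p (w, s)) p := by
      intro p
      by_cases hp : T p ∈ U
      · have := h.mem_iff _ hp
        rw [T.symm_apply_apply] at this
        simp only [Set.indicator, Set.mem_ofPred_eq, this, hcomp]
      · have h0 : fderiv ℝ f (T p) = 0 := by
          have : T p ∉ tsupport (fderiv ℝ f) := fun h' => hp (hfU (tsupport_fderiv_subset ℝ h'))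
          exact image_eq_zero_of_notMem_tsupport this
        simp [Set.indicator, hcomp, h0]
    have hint : Integrable (fun p => fderiv ℝ (fun p => f (T p)) p (w, s)) := by
      have hc1 : ContDiff ℝ 1 fun p => f (T p) := hf.comp T.contDiff
      refine Continuous.integrable_of_hasCompactSupport
        ((hc1.continuous_fderiv one_ne_zero).clm_apply continuous_const) ?_
      exact (hfc.comp_homeomorph T.toHomeomorph).fderiv_apply ℝ _
    rw [← integral_indicator hΩ.measurableSet, ← h.isFrame.measurePreserving.integral_comp
      T.toHomeomorph.measurableEmbedding]
    simp_rw [hind]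
    rw [Measure.volume_eq_prod, integral_prod _ (by
      rw [← Measure.volume_eq_prod]; exact hint.indicator hmeas)]
    congr 1
    ext y
    -- The domain is the strict subgraph; the endpoint of each vertical line is null.
    rw [integral_Iic_eq_integral_Iio, ← integral_indicator measurableSet_Iio]
    rfl
  rw [hL, hR]
  exact integral_subgraph_fderiv hψ1 (hf.comp T.contDiff)
    (hfc.comp_homeomorph T.toHomeomorph) w s

theorem integral_fderiv_of_tsupport_subset {Ω : Set Vec3} (hΩ : IsOpen Ω) {f : Vec3 → ℝ}
    (hf : ContDiff ℝ 1 f) (hfc : HasCompactSupport f) (hfU : tsupport f ⊆ Ω) (v : Vec3) :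
    ∫ x in Ω, fderiv ℝ f x v = ∫ x, f x * inner ℝ (outerNormal Ω x) v ∂surf Ω := by
  have hR : ∫ x, f x * inner ℝ (outerNormal Ω x) v ∂surf Ω = 0 := by
    refine integral_eq_zero_of_ae ?_
    filter_upwards [ae_surf_mem_frontier Ω] with x hx
    rw [hΩ.frontier_eq] at hx
    have : f x = 0 := image_eq_zero_of_notMem_tsupport fun h' => hx.2 (hfU h')
    simp [this]
  rw [hR, setIntegral_eq_integral_of_forall_compl_eq_zero, integral_fderiv_eq_zero _ hf hfc]
  intro x hx
  have : x ∉ tsupport (fderiv ℝ f) := fun h' => hx (hfU (tsupport_fderiv_subset ℝ h'))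
  rw [image_eq_zero_of_notMem_tsupport this]
  rfl

/-- The **divergence theorem** on bounded domains of class `C²`, for one directional derivative. -/
theorem integral_fderiv_eq_surf {Ω : Set Vec3} (hΩ : IsOpen Ω) (hΩb : Bornology.IsBounded Ω)
    (hΩ2 : HasC2Boundary Ω) {f : Vec3 → ℝ} (hf : ContDiff ℝ 1 f) (v : Vec3) :
    ∫ x in Ω, fderiv ℝ f x v = ∫ x, f x * inner ℝ (outerNormal Ω x) v ∂surf Ω := by
  have hloc : ∀ x ∈ closure Ω, ∃ U : Set Vec3, IsOpen U ∧ x ∈ U ∧ Bornology.IsBounded U ∧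
      ∀ g : Vec3 → ℝ, ContDiff ℝ 1 g → HasCompactSupport g → tsupport g ⊆ U →
        ∫ x in Ω, fderiv ℝ g x v = ∫ x, g x * inner ℝ (outerNormal Ω x) v ∂surf Ω := by
    intro x hx
    by_cases hxΩ : x ∈ Ω
    · exact ⟨Ω, hΩ, hxΩ, hΩb, fun g hg hgc hgU =>
        integral_fderiv_of_tsupport_subset hΩ hg hgc hgU v⟩
    · obtain ⟨T, ψ, U, hxU, h⟩ := exists_isGraphChart hΩ hΩ2 (x₀ := x)
        (by rw [hΩ.frontier_eq]; exact ⟨hx, hxΩ⟩)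
      -- The ball makes the set bounded, so that functions supported in it have compact support.
      exact ⟨U ∩ Metric.ball x 1, h.isOpen.inter Metric.isOpen_ball,
        ⟨hxU, Metric.mem_ball_self one_pos⟩, Metric.isBounded_ball.subset Set.inter_subset_right,
        fun g hg hgc hgU => h.integral_fderiv hΩ hg hgc (hgU.trans Set.inter_subset_left) v⟩
  choose! U hUo hUx hUb hU using hloc
  obtain ⟨t, htU⟩ := hΩb.isCompact_closure.elim_nhds_subcover' (fun x _ => U x)
    fun x hx => (hUo x hx).mem_nhds (hUx x hx)
  obtain ⟨p, hp⟩ := SmoothPartitionOfUnity.exists_isSubordinate 𝓘(ℝ, Vec3)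
    (s := closure Ω) isClosed_closure (fun i : t => U i.1) (fun i => hUo _ i.1.2) (by
      intro x hx
      obtain ⟨i, hi, hxi⟩ := Set.mem_iUnion₂.1 (htU hx)
      exact Set.mem_iUnion.2 ⟨⟨i, hi⟩, hxi⟩)
  have hpC : ∀ i, ContDiff ℝ 1 (p i) := fun i =>
    ((p i).contMDiff.contDiff).of_le (by exact_mod_cast le_top)
  let g : t → Vec3 → ℝ := fun i x => p i x * f x
  have hgC : ∀ i, ContDiff ℝ 1 (g i) := fun i => (hpC i).mul hf
  have hgs : ∀ i, tsupport (g i) ⊆ U i.1 := fun i => (tsupport_mul_subset_left).trans (hp i)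
  have hgc : ∀ i, HasCompactSupport (g i) := fun i =>
    Metric.isCompact_of_isClosed_isBounded (isClosed_tsupport _)
      ((hUb i.1 i.1.2).subset (hgs i))
  have hsum : ∀ x ∈ closure Ω, f x = ∑ i, g i x := fun x hx => by
    have := p.sum_eq_one hx
    rw [finsum_eq_sum_of_fintype] at this
    simp only [g]
    rw [← Finset.sum_mul, this, one_mul]
  have h1 : ∫ x in Ω, fderiv ℝ f x v = ∑ i, ∫ x in Ω, fderiv ℝ (g i) x v := by
    rw [← integral_finsetSum]
    · refine setIntegral_congr_fun hΩ.measurableSet fun x hx => ?_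
      -- The pieces sum to `f` only on the closure of `Ω`, which is enough for derivatives at points
      -- of the open set.
      have hev : f =ᶠ[𝓝 x] fun y => ∑ i, g i y := by
        filter_upwards [hΩ.mem_nhds hx] with y hy
        exact hsum y (subset_closure hy)
      have hd : HasFDerivAt (fun y => ∑ i, g i y) (∑ i, fderiv ℝ (g i) x) x :=
        HasFDerivAt.fun_sum fun i _ => ((hgC i).differentiable one_ne_zero x).hasFDerivAt
      rw [hev.fderiv_eq, hd.fderiv, _root_.sum_apply]
    · intro i _
      exact (Continuous.integrable_of_hasCompactSupport
        (((hgC i).continuous_fderiv one_ne_zero).clm_apply continuous_const)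
        ((hgc i).fderiv_apply ℝ v)).integrableOn
  have h2 : ∫ x, f x * inner ℝ (outerNormal Ω x) v ∂surf Ω =
      ∑ i, ∫ x, g i x * inner ℝ (outerNormal Ω x) v ∂surf Ω := by
    rw [← integral_finsetSum]
    · refine integral_congr_ae ?_
      filter_upwards [ae_surf_mem_frontier Ω] with x hx
      rw [hsum x (frontier_subset_closure hx), Finset.sum_mul]
    · intro i _
      refine integrable_surf_of_continuousOn hΩ hΩb hΩ2 ?_
      exact (hgC i).continuous.continuousOn.mul
        ((continuousOn_outerNormal hΩ hΩ2).inner continuousOn_const)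
  rw [h1, h2]
  exact Finset.sum_congr rfl fun i _ => hU i.1 i.1.2 _ (hgC i) (hgc i) (hgs i)

/-! ### Partial derivatives -/

theorem contDiff_pderiv {f : Vec3 → ℝ} (hf : ContDiff ℝ 2 f) (k : Fin 3) :
    ContDiff ℝ 1 (pderiv k f) :=
  (hf.fderiv_right (m := 1) (by norm_num)).clm_apply contDiff_const

theorem continuous_pderiv {f : Vec3 → ℝ} (hf : ContDiff ℝ 1 f) (k : Fin 3) :
    Continuous (pderiv k f) :=
  (hf.continuous_fderiv one_ne_zero).clm_apply continuous_const

theorem pderiv_mul {f g : Vec3 → ℝ} (hf : ContDiff ℝ 1 f) (hg : ContDiff ℝ 1 g) (k : Fin 3)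
    (x : Vec3) : pderiv k (fun y => f y * g y) x = f x * pderiv k g x + pderiv k f x * g x := by
  rw [pderiv, fderiv_fun_mul (hf.differentiable one_ne_zero x) (hg.differentiable one_ne_zero x)]
  simp [pderiv, mul_comm]

theorem pderiv_sum_mul {ι : Type*} (s : Finset ι) {f : ι → Vec3 → ℝ}
    (hf : ∀ i ∈ s, Differentiable ℝ (f i)) (a : ι → ℝ) (k : Fin 3) (x : Vec3) :
    pderiv k (fun y => ∑ i ∈ s, f i y * a i) x = ∑ i ∈ s, pderiv k (f i) x * a i := by
  have h : HasFDerivAt (fun y => ∑ i ∈ s, f i y * a i) (∑ i ∈ s, a i • fderiv ℝ (f i) x) x :=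
    HasFDerivAt.fun_sum fun i hi => ((hf i hi) x).hasFDerivAt.mul_const (a i)
  rw [pderiv, h.fderiv, _root_.sum_apply]
  simp [pderiv, mul_comm]

theorem gradient_apply (ρ : Vec3 → ℝ) (x : Vec3) (j : Fin 3) : gradient ρ x j = pderiv j ρ x := by
  rw [pderiv, ← inner_gradient_left, EuclideanSpace.inner_single_right]
  simp

theorem memLp_of_continuous {Ω : Set Vec3} (hΩb : Bornology.IsBounded Ω) {f : Vec3 → ℝ}
    (hf : Continuous f) (p : ℝ≥0∞) : MemLp f p (volume.restrict Ω) := by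
  have : IsFiniteMeasure (volume.restrict Ω : Measure Vec3) := ⟨by
    rw [Measure.restrict_apply_univ]; exact hΩb.measure_lt_top⟩
  obtain ⟨C, hC⟩ := hΩb.isCompact_closure.exists_bound_of_continuousOn hf.continuousOn
  refine MemLp.of_bound hf.aestronglyMeasurable C ?_
  have hcl : ∀ᵐ x ∂(volume.restrict (closure Ω) : Measure Vec3), ‖f x‖ ≤ C :=
    (ae_restrict_iff' isClosed_closure.measurableSet).2 (Eventually.of_forall hC)
  exact ae_mono (Measure.restrict_mono subset_closure le_rfl) hcl

theorem memLp_surf_of_continuousOn {Ω : Set Vec3} (hΩ : IsOpen Ω) (hΩb : Bornology.IsBounded Ω)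
    (hΩ2 : HasC2Boundary Ω) {f : Vec3 → ℝ} (hf : ContinuousOn f (frontier Ω)) (p : ℝ≥0∞) :
    MemLp f p (surf Ω) := by
  have := isFiniteMeasure_surf hΩ hΩb hΩ2
  obtain ⟨C, hC⟩ := (isCompact_frontier hΩb).exists_bound_of_continuousOn hf
  refine MemLp.of_bound (integrable_surf_of_continuousOn hΩ hΩb hΩ2 hf).aestronglyMeasurable C ?_
  filter_upwards [ae_surf_mem_frontier Ω] with x hx using hC x hx

/-! ### Weak gradients -/

theorem hasWeakGrad_weakGrad {Ω : Set Vec3} {P : Vec3 → Mat3} (h : MemH1 Ω P) :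
    HasWeakGrad Ω P (weakGrad Ω P) := by
  rw [weakGrad, dif_pos h]
  exact h.choose_spec

/-- The fundamental lemma of the calculus of variations, entry by entry; it makes the choice in
`weakGrad` harmless under integrals. -/
theorem HasWeakGrad.ae_eq {Ω : Set Vec3} (hΩ : IsOpen Ω) (hΩb : Bornology.IsBounded Ω)
    {P : Vec3 → Mat3} {G G' : Vec3 → Tensor3} (h : HasWeakGrad Ω P G) (h' : HasWeakGrad Ω P G') :
    ∀ᵐ x ∂volume.restrict Ω, G x = G' x := by
  have : IsFiniteMeasure (volume.restrict Ω : Measure Vec3) := ⟨by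
    rw [Measure.restrict_apply_univ]; exact hΩb.measure_lt_top⟩
  have key : ∀ i j k, ∀ᵐ x ∂volume.restrict Ω, G x i j k = G' x i j k := by
    intro i j k
    have hi : IntegrableOn (fun x => G x i j k) Ω := (h.2.1 i j k).integrable one_le_two
    have hi' : IntegrableOn (fun x => G' x i j k) Ω := (h'.2.1 i j k).integrable one_le_two
    have hae := hΩ.ae_eq_zero_of_integral_contDiff_smul_eq_zero (μ := volume)
      (f := fun x => G x i j k - G' x i j k) (hi.sub hi').locallyIntegrableOn (by
        intro φ hφ hφc hφΩ
        have hb : ∀ F : Vec3 → ℝ, IntegrableOn F Ω → IntegrableOn (fun x => F x * φ x) Ω :=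
          fun F hF => by
            obtain ⟨C, hC⟩ := hφc.exists_bound_of_continuous hφ.continuous
            exact hF.mul_bdd hφ.continuous.aestronglyMeasurable (Eventually.of_forall hC)
        rw [← setIntegral_eq_integral_of_forall_compl_eq_zero (s := Ω)]
        · have e1 := h.2.2 i j k φ hφ hφc hφΩ
          have e2 := h'.2.2 i j k φ hφ hφc hφΩ
          have e3 : ∫ x in Ω, G x i j k * φ x = ∫ x in Ω, G' x i j k * φ x := by linarith
          have : ∀ x, φ x • (G x i j k - G' x i j k) = G x i j k * φ x - G' x i j k * φ x :=
            fun x => by rw [smul_eq_mul]; ring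
          simp_rw [this]
          rw [integral_sub (hb _ hi) (hb _ hi'), e3, sub_self]
        · intro x hx
          rw [image_eq_zero_of_notMem_tsupport fun h' => hx (hφΩ h'), zero_smul])
    rw [ae_restrict_iff' hΩ.measurableSet]
    filter_upwards [hae] with x hx hxΩ using sub_eq_zero.1 (hx hxΩ)
  simp only [← ae_all_iff] at key
  filter_upwards [key] with x hx
  funext i j k
  exact hx i j k

theorem HasWeakGrad.add_smul {Ω : Set Vec3} (hΩb : Bornology.IsBounded Ω)
    {P δP : Vec3 → Mat3} {G G' : Vec3 → Tensor3}
    (h : HasWeakGrad Ω P G) (h' : HasWeakGrad Ω δP G') (t : ℝ) :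
    HasWeakGrad Ω (P + t • δP) (G + t • G') := by
  refine ⟨fun i j => (h.1 i j).add ((h'.1 i j).const_mul t),
    fun i j k => (h.2.1 i j k).add ((h'.2.1 i j k).const_mul t), fun i j k φ hφ hφc hφΩ => ?_⟩
  have hφ1 : ContDiff ℝ 1 φ := hφ.of_le (by exact_mod_cast le_top)
  have hφL := memLp_of_continuous hΩb hφ.continuous 2
  have hφ'L := memLp_of_continuous hΩb (continuous_pderiv hφ1 k) 2
  have e1 : ∀ x, (P + t • δP) x i j * pderiv k φ x =
      P x i j * pderiv k φ x + t * (δP x i j * pderiv k φ x) := fun x => by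
    simp [add_mul, mul_assoc]
  have e2 : ∀ x, (G + t • G') x i j k * φ x = G x i j k * φ x + t * (G' x i j k * φ x) :=
    fun x => by simp [add_mul, mul_assoc]
  simp_rw [e1, e2]
  have i1 : Integrable (fun x => P x i j * pderiv k φ x) (volume.restrict Ω) :=
    (h.1 i j).integrable_mul hφ'L
  have i2 : Integrable (fun x => δP x i j * pderiv k φ x) (volume.restrict Ω) :=
    (h'.1 i j).integrable_mul hφ'L
  have i3 : Integrable (fun x => G x i j k * φ x) (volume.restrict Ω) :=
    (h.2.1 i j k).integrable_mul hφL
  have i4 : Integrable (fun x => G' x i j k * φ x) (volume.restrict Ω) :=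
    (h'.2.1 i j k).integrable_mul hφL
  rw [integral_add i1 (i2.const_mul t), integral_add i3 (i4.const_mul t), integral_const_mul,
    integral_const_mul, h.2.2 i j k φ hφ hφc hφΩ, h'.2.2 i j k φ hφ hφc hφΩ]
  ring

theorem hasWeakGrad_grad {Ω : Set Vec3} (hΩb : Bornology.IsBounded Ω)
    {P : Vec3 → Mat3} (hP : ∀ i j, ContDiff ℝ 1 fun x => P x i j) : HasWeakGrad Ω P (grad P) := by
  refine ⟨fun i j => memLp_of_continuous hΩb (hP i j).continuous 2,
    fun i j k => memLp_of_continuous hΩb (continuous_pderiv (hP i j) k) 2,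
    fun i j k φ hφ hφc hφΩ => ?_⟩
  have hφ1 : ContDiff ℝ 1 φ := hφ.of_le (by exact_mod_cast le_top)
  have hφ0 : ∀ x, x ∉ Ω → φ x = 0 := fun x hx =>
    image_eq_zero_of_notMem_tsupport fun h' => hx (hφΩ h')
  have hφ'0 : ∀ x, x ∉ Ω → pderiv k φ x = 0 := fun x hx => by
    have : x ∉ tsupport (fderiv ℝ φ) := fun h' => hx (hφΩ (tsupport_fderiv_subset ℝ h'))
    rw [pderiv, image_eq_zero_of_notMem_tsupport this]
    rfl
  have hφ'c : HasCompactSupport (pderiv k φ) := hφc.fderiv_apply ℝ _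
  rw [setIntegral_eq_integral_of_forall_compl_eq_zero fun x hx => by rw [hφ'0 x hx, mul_zero],
    setIntegral_eq_integral_of_forall_compl_eq_zero fun x hx => by rw [hφ0 x hx, mul_zero]]
  refine integral_mul_fderiv_eq_neg_fderiv_mul_of_integrable ?_ ?_ ?_
    (fun x _ => (hP i j).differentiable one_ne_zero x) (fun x _ => hφ1.differentiable one_ne_zero x)
  · exact ((continuous_pderiv (hP i j) k).mul hφ.continuous).integrable_of_hasCompactSupport
      hφc.mul_left
  · exact ((hP i j).continuous.mul (continuous_pderiv hφ1 k)).integrable_of_hasCompactSupport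
      hφ'c.mul_left
  · exact ((hP i j).continuous.mul hφ.continuous).integrable_of_hasCompactSupport hφc.mul_left

theorem weakGrad_ae_eq {Ω : Set Vec3} (hΩ : IsOpen Ω) (hΩb : Bornology.IsBounded Ω)
    {P : Vec3 → Mat3} {G : Vec3 → Tensor3} (h : HasWeakGrad Ω P G) :
    ∀ᵐ x ∂volume.restrict Ω, weakGrad Ω P x = G x :=
  (hasWeakGrad_weakGrad ⟨G, h⟩).ae_eq hΩ hΩb h

/-- The constant sequence approximates, as the classical gradient is the weak one. This admits the
`C¹` test fields used for localization. -/
theorem isTrace_of_contDiff {Ω : Set Vec3} (hΩ : IsOpen Ω) (hΩb : Bornology.IsBounded Ω)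
    (hΩ2 : HasC2Boundary Ω) {P : Vec3 → Mat3} (hP : ∀ i j, ContDiff ℝ 1 fun x => P x i j) :
    IsTrace Ω P P := by
  have hw := hasWeakGrad_grad hΩb hP
  refine ⟨⟨_, hw⟩, fun i j => memLp_surf_of_continuousOn hΩ hΩb hΩ2 (hP i j).continuous.continuousOn
    2, fun _ => P, fun _ => hP, by simp, fun i j k => ?_, by simp⟩
  have : eLpNorm (fun x => grad P x i j k - weakGrad Ω P x i j k) 2 (volume.restrict Ω) = 0 := by
    rw [eLpNorm_congr_ae (g := fun _ => (0 : ℝ))]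
    · simp
    · filter_upwards [weakGrad_ae_eq hΩ hΩb hw] with x hx
      rw [hx, sub_self]
  simp [this]

/-! ### Green's formula -/

/-- Cauchy–Schwarz, with `a` fixed: `L²` convergence of `Q n` gives `L¹` convergence of the
products. -/
theorem tendsto_integral_mul_of_eLpNorm {X : Type*} [MeasurableSpace X] {μ : Measure X}
    {a q : X → ℝ} {Q : ℕ → X → ℝ} (ha : MemLp a 2 μ) (hq : MemLp q 2 μ) (hQ : ∀ n, MemLp (Q n) 2 μ)
    (h : Tendsto (fun n => eLpNorm (fun x => Q n x - q x) 2 μ) atTop (𝓝 0)) :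
    Tendsto (fun n => ∫ x, a x * Q n x ∂μ) atTop (𝓝 (∫ x, a x * q x ∂μ)) := by
  refine tendsto_integral_of_L1' _ (ha.integrable_mul hq).aestronglyMeasurable
    (Eventually.of_forall fun n => ha.integrable_mul (hQ n)) ?_
  have hlim : Tendsto (fun n => eLpNorm a 2 μ * eLpNorm (fun x => Q n x - q x) 2 μ) atTop
      (𝓝 0) := by
    simpa using ENNReal.Tendsto.const_mul h (Or.inr ha.eLpNorm_lt_top.ne)
  refine tendsto_of_tendsto_of_tendsto_of_le_of_le tendsto_const_nhds hlim (fun _ => zero_le)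
    fun n => ?_
  have := eLpNorm_smul_le_mul_eLpNorm (p := 2) (q := 2) (r := 1)
    ((hQ n).sub hq).aestronglyMeasurable
    ha.aestronglyMeasurable
  refine le_trans (le_of_eq ?_) this
  congr 1
  ext x
  simp [mul_sub]

theorem integral_mul_pderiv {Ω : Set Vec3} (hΩ : IsOpen Ω) (hΩb : Bornology.IsBounded Ω)
    (hΩ2 : HasC2Boundary Ω) {a u : Vec3 → ℝ} (ha : ContDiff ℝ 1 a) (hu : ContDiff ℝ 1 u)
    (k : Fin 3) :
    ∫ x in Ω, a x * pderiv k u x =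
      (∫ x, a x * outerNormal Ω x k * u x ∂surf Ω) - ∫ x in Ω, pderiv k a x * u x := by
  have h := integral_fderiv_eq_surf hΩ hΩb hΩ2 (ha.mul hu) (EuclideanSpace.single k 1)
  have e1 : ∀ x, fderiv ℝ (fun x => a x * u x) x (EuclideanSpace.single k 1) =
      a x * pderiv k u x + pderiv k a x * u x := fun x => pderiv_mul ha hu k x
  have hi : ∀ f g : Vec3 → ℝ, Continuous f → Continuous g →
      IntegrableOn (fun x => f x * g x) Ω := fun f g hf hg =>
    memLp_one_iff_integrable.1 (memLp_of_continuous hΩb (hf.mul hg) 1)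
  rw [integral_congr_ae (Eventually.of_forall e1),
    integral_add (hi _ _ ha.continuous (continuous_pderiv hu k))
    (hi _ _ (continuous_pderiv ha k) hu.continuous)] at h
  have e2 : ∀ x, a x * u x * inner ℝ (outerNormal Ω x) (EuclideanSpace.single k 1) =
      a x * outerNormal Ω x k * u x := fun x => by
    rw [EuclideanSpace.inner_single_right]
    simp
    ring
  rw [integral_congr_ae (Eventually.of_forall e2)] at h
  linarith

/-- Each term of the classical formula is an `L²` pairing with a fixed function, hence passes to the
limit along the sequence in the definition of the trace. -/
theorem IsTrace.integral_mul_weakGrad {Ω : Set Vec3} (hΩ : IsOpen Ω)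
    (hΩb : Bornology.IsBounded Ω) (hΩ2 : HasC2Boundary Ω) {P g : Vec3 → Mat3} (h : IsTrace Ω P g)
    {a : Vec3 → ℝ} (ha : ContDiff ℝ 1 a) (i j k : Fin 3) :
    ∫ x in Ω, a x * weakGrad Ω P x i j k =
      (∫ x, a x * outerNormal Ω x k * g x i j ∂surf Ω) - ∫ x in Ω, pderiv k a x * P x i j := by
  obtain ⟨hP, hg, Q, hQ, hQ0, hQ1, hQb⟩ := h
  have hw := hasWeakGrad_weakGrad hP
  have hν : ContinuousOn (fun x => a x * outerNormal Ω x k) (frontier Ω) := by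
    refine ha.continuous.continuousOn.mul ?_
    exact (EuclideanSpace.proj (𝕜 := ℝ) k).continuous.comp_continuousOn
      (continuousOn_outerNormal hΩ hΩ2)
  have l1 := tendsto_integral_mul_of_eLpNorm (memLp_of_continuous hΩb ha.continuous 2)
    (hw.2.1 i j k) (fun n => memLp_of_continuous hΩb (continuous_pderiv (hQ n i j) k) 2)
    (hQ1 i j k)
  have l2 := tendsto_integral_mul_of_eLpNorm (memLp_of_continuous hΩb (continuous_pderiv ha k) 2)
    (hw.1 i j) (fun n => memLp_of_continuous hΩb (hQ n i j).continuous 2) (hQ0 i j)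
  have l3 := tendsto_integral_mul_of_eLpNorm (memLp_surf_of_continuousOn hΩ hΩb hΩ2 hν 2)
    (hg i j) (fun n => memLp_surf_of_continuousOn hΩ hΩb hΩ2 (hQ n i j).continuous.continuousOn 2)
    (hQb i j)
  refine tendsto_nhds_unique l1 ((l3.sub l2).congr fun n => ?_)
  exact (integral_mul_pderiv hΩ hΩb hΩ2 ha (hQ n i j) k).symm

/-- Euclidean scalar product of third order tensors. -/
def tensorInner (M N : Tensor3) : ℝ := ∑ i, ∑ j, ∑ k, M i j k * N i j k

theorem integrable_tensorInner {X : Type*} [MeasurableSpace X] {μ : Measure X}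
    {M N : X → Tensor3} (hM : ∀ i j k, MemLp (fun x => M x i j k) 2 μ)
    (hN : ∀ i j k, MemLp (fun x => N x i j k) 2 μ) :
    Integrable (fun x => tensorInner (M x) (N x)) μ :=
  integrable_finsetSum _ fun i _ => integrable_finsetSum _ fun j _ =>
    integrable_finsetSum _ fun k _ => (hM i j k).integrable_mul (hN i j k)

theorem integrable_mdot {X : Type*} [MeasurableSpace X] {μ : Measure X}
    {A B : X → Mat3} (hA : ∀ i j, MemLp (fun x => A x i j) 2 μ)
    (hB : ∀ i j, MemLp (fun x => B x i j) 2 μ) :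
    Integrable (fun x => mdot (A x) (B x)) μ :=
  integrable_finsetSum _ fun i _ => integrable_finsetSum _ fun j _ =>
    (hA i j).integrable_mul (hB i j)

theorem continuousOn_tdot_outerNormal {Ω : Set Vec3} (hΩ : IsOpen Ω) (hΩ2 : HasC2Boundary Ω)
    {m : Vec3 → Tensor3} (hm : ∀ i j k, Continuous fun x => m x i j k) (i j : Fin 3) :
    ContinuousOn (fun x => tdot (m x) (outerNormal Ω x) i j) (frontier Ω) := by
  have hν : ∀ k, ContinuousOn (fun x => outerNormal Ω x k) (frontier Ω) := fun k =>
    (EuclideanSpace.proj (𝕜 := ℝ) k).continuous.comp_continuousOn (continuousOn_outerNormal hΩ hΩ2)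
  simp only [tdot, Matrix.of_apply]
  exact continuousOn_finsetSum _ fun k _ => (hm i j k).continuousOn.mul (hν k)

theorem continuous_DIV {m : Vec3 → Tensor3} (hm : ∀ i j k, ContDiff ℝ 1 fun x => m x i j k)
    (i j : Fin 3) : Continuous fun x => DIV m x i j := by
  simp only [DIV, Matrix.of_apply]
  exact continuous_finsetSum _ fun k _ => continuous_pderiv (hm i j k) k

/-- **Green's formula** for a tensor field of class `C¹` and a matrix field in `H¹`. -/
theorem IsTrace.integral_tensorInner_weakGrad {Ω : Set Vec3} (hΩ : IsOpen Ω)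
    (hΩb : Bornology.IsBounded Ω) (hΩ2 : HasC2Boundary Ω) {P g : Vec3 → Mat3} (h : IsTrace Ω P g)
    {m : Vec3 → Tensor3} (hm : ∀ i j k, ContDiff ℝ 1 fun x => m x i j k) :
    ∫ x in Ω, tensorInner (m x) (weakGrad Ω P x) =
      (∫ x, mdot (tdot (m x) (outerNormal Ω x)) (g x) ∂surf Ω) -
        ∫ x in Ω, mdot (DIV m x) (P x) := by
  have hw := hasWeakGrad_weakGrad h.1
  have hν : ∀ k, ContinuousOn (fun x => outerNormal Ω x k) (frontier Ω) := fun k =>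
    (EuclideanSpace.proj (𝕜 := ℝ) k).continuous.comp_continuousOn (continuousOn_outerNormal hΩ hΩ2)
  have i1 : ∀ i j k, Integrable (fun x => m x i j k * weakGrad Ω P x i j k) (volume.restrict Ω) :=
    fun i j k => (memLp_of_continuous hΩb (hm i j k).continuous 2).integrable_mul (hw.2.1 i j k)
  have i2 : ∀ i j k, Integrable (fun x => m x i j k * outerNormal Ω x k * g x i j) (surf Ω) :=
    fun i j k => (memLp_surf_of_continuousOn hΩ hΩb hΩ2
      ((hm i j k).continuous.continuousOn.mul (hν k)) 2).integrable_mul (h.2.1 i j)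
  have i3 : ∀ i j k, Integrable (fun x => pderiv k (fun y => m y i j k) x * P x i j)
      (volume.restrict Ω) := fun i j k =>
    (memLp_of_continuous hΩb (continuous_pderiv (hm i j k) k) 2).integrable_mul (hw.1 i j)
  have e1 : ∫ x in Ω, tensorInner (m x) (weakGrad Ω P x) =
      ∑ i, ∑ j, ∑ k, ∫ x in Ω, m x i j k * weakGrad Ω P x i j k := by
    simp only [tensorInner]
    rw [integral_finsetSum _ fun i _ => integrable_finsetSum _ fun j _ =>
      integrable_finsetSum _ fun k _ => i1 i j k]
    refine Finset.sum_congr rfl fun i _ => ?_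
    rw [integral_finsetSum _ fun j _ => integrable_finsetSum _ fun k _ => i1 i j k]
    refine Finset.sum_congr rfl fun j _ => ?_
    rw [integral_finsetSum _ fun k _ => i1 i j k]
  have e2 : ∫ x, mdot (tdot (m x) (outerNormal Ω x)) (g x) ∂surf Ω =
      ∑ i, ∑ j, ∑ k, ∫ x, m x i j k * outerNormal Ω x k * g x i j ∂surf Ω := by
    simp only [mdot, tdot, Matrix.of_apply, Finset.sum_mul]
    rw [integral_finsetSum _ fun i _ => integrable_finsetSum _ fun j _ =>
      integrable_finsetSum _ fun k _ => i2 i j k]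
    refine Finset.sum_congr rfl fun i _ => ?_
    rw [integral_finsetSum _ fun j _ => integrable_finsetSum _ fun k _ => i2 i j k]
    refine Finset.sum_congr rfl fun j _ => ?_
    rw [integral_finsetSum _ fun k _ => i2 i j k]
  have e3 : ∫ x in Ω, mdot (DIV m x) (P x) =
      ∑ i, ∑ j, ∑ k, ∫ x in Ω, pderiv k (fun y => m y i j k) x * P x i j := by
    simp only [mdot, DIV, Matrix.of_apply, Finset.sum_mul]
    rw [integral_finsetSum _ fun i _ => integrable_finsetSum _ fun j _ =>
      integrable_finsetSum _ fun k _ => i3 i j k]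
    refine Finset.sum_congr rfl fun i _ => ?_
    rw [integral_finsetSum _ fun j _ => integrable_finsetSum _ fun k _ => i3 i j k]
    refine Finset.sum_congr rfl fun j _ => ?_
    rw [integral_finsetSum _ fun k _ => i3 i j k]
  rw [e1, e2, e3]
  simp only [← Finset.sum_sub_distrib]
  refine Finset.sum_congr rfl fun i _ => Finset.sum_congr rfl fun j _ =>
    Finset.sum_congr rfl fun k _ => ?_
  exact h.integral_mul_weakGrad hΩ hΩb hΩ2 (hm i j k) i j k

/-! ### Algebra of the curvature energy -/

/-- The constitutive map of the curvature energy, on slices of third order tensors. -/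
def curvMap (c : CurvParams) : Mat3 →ₗ[ℝ] Mat3 where
  toFun A := (c.μ * c.Lc ^ 2) • (c.a₁ • dev (sym A) + c.a₂ • skew A +
    (2 / 3 * c.a₃) • (A.trace • (1 : Mat3)))
  map_add' A B := by
    ext i j
    simp [dev, sym, skew, Matrix.trace_add]
    ring
  map_smul' r A := by
    ext i j
    simp [dev, sym, skew, Matrix.trace_add]
    ring

/-- `A ↦ dev sym A` as a linear map. -/
def devSymLin : Mat3 →ₗ[ℝ] Mat3 where
  toFun A := dev (sym A)
  map_add' A B := by
    ext i j
    simp [dev, sym, Matrix.trace_add]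
    ring
  map_smul' r A := by
    ext i j
    simp [dev, sym, Matrix.trace_add]
    ring

/-- `A ↦ skew A` as a linear map. -/
def skewLin : Mat3 →ₗ[ℝ] Mat3 where
  toFun A := skew A
  map_add' A B := by
    ext i j
    simp [skew]
    ring
  map_smul' r A := by
    ext i j
    simp [skew]
    ring

/-- `A ↦ tr A · 1` as a linear map. -/
def trLin : Mat3 →ₗ[ℝ] Mat3 where
  toFun A := A.trace • (1 : Mat3)
  map_add' A B := by simp [Matrix.trace_add, add_smul]
  map_smul' r A := by simp [Matrix.trace_smul, mul_smul]

theorem linearMap_apply_eq_sum (L : Mat3 →ₗ[ℝ] Mat3) (A : Mat3) (i j : Fin 3) :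
    L A i j = ∑ p : Fin 3 × Fin 3, A p.1 p.2 * L (Matrix.single p.1 p.2 1) i j := by
  conv_lhs => rw [Matrix.matrix_eq_sum_single A]
  simp only [map_sum, Matrix.sum_apply, Fintype.sum_prod_type]
  refine Finset.sum_congr rfl fun a _ => Finset.sum_congr rfl fun b _ => ?_
  have : Matrix.single a b (A a b) = A a b • Matrix.single a b (1 : ℝ) := by simp
  rw [this, map_smul]
  rfl

/-- A linear map has constant coefficients in the matrix entries, so it commutes with
differentiation. -/
theorem grad_linearMap (L : Mat3 →ₗ[ℝ] Mat3) {P : Vec3 → Mat3}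
    (hP : ∀ i j, Differentiable ℝ fun x => P x i j) (x : Vec3) :
    grad (fun y => L (P y)) x = onSlices L (grad P x) := by
  funext i j k
  simp only [grad, onSlices]
  rw [linearMap_apply_eq_sum]
  simp_rw [fun y => linearMap_apply_eq_sum L (P y) i j]
  exact pderiv_sum_mul _ (fun p _ => hP p.1 p.2) _ k x

theorem momentStress_eq (c : CurvParams) {P : Vec3 → Mat3}
    (hP : ∀ i j, Differentiable ℝ fun x => P x i j) (x : Vec3) :
    momentStress c P x = onSlices (curvMap c) (grad P x) := by
  have h1 := grad_linearMap devSymLin hP x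
  have h2 := grad_linearMap skewLin hP x
  have h3 := grad_linearMap trLin hP x
  change grad (fun y => dev (sym (P y))) x = _ at h1
  change grad (fun y => skew (P y)) x = _ at h2
  change grad (fun y => (P y).trace • (1 : Mat3)) x = _ at h3
  rw [momentStress, h1, h2, h3]
  rfl

theorem onSlices_linearMap_apply (L : Mat3 →ₗ[ℝ] Mat3) (M : Tensor3) (i j k : Fin 3) :
    onSlices L M i j k =
      ∑ p : Fin 3 × Fin 3, M p.1 p.2 k * L (Matrix.single p.1 p.2 1) i j :=
  linearMap_apply_eq_sum L _ i j

theorem contDiff_momentStress (c : CurvParams) {P : Vec3 → Mat3}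
    (hP : ∀ i j, ContDiff ℝ 2 fun x => P x i j) (i j k : Fin 3) :
    ContDiff ℝ 1 fun x => momentStress c P x i j k := by
  simp_rw [momentStress_eq c (fun i j => (hP i j).differentiable two_ne_zero),
    onSlices_linearMap_apply]
  exact ContDiff.sum fun p _ => (contDiff_pderiv (hP p.1 p.2) k).mul contDiff_const

/-- `dev ∘ sym` and `skew` are orthogonal projections, so one of two factors may be replaced by `B`
in the cross terms. For the trace part `⟨tr A · 1, tr B · 1⟩ = 3 ⟨tr A · 1, B⟩`, whence `2/9`
becomes `2/3`. -/
theorem slice_energy_expand (a b d r : ℝ) (A B : Mat3) :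
    a * mdot (dev (sym (A + r • B))) (dev (sym (A + r • B))) +
      b * mdot (skew (A + r • B)) (skew (A + r • B)) +
      2 / 9 * d * mdot ((A + r • B).trace • (1 : Mat3)) ((A + r • B).trace • (1 : Mat3)) =
    (a * mdot (dev (sym A)) (dev (sym A)) + b * mdot (skew A) (skew A) +
      2 / 9 * d * mdot (A.trace • (1 : Mat3)) (A.trace • (1 : Mat3))) +
    2 * r * mdot (a • dev (sym A) + b • skew A + (2 / 3 * d) • (A.trace • (1 : Mat3))) B +
    r ^ 2 * (a * mdot (dev (sym B)) (dev (sym B)) + b * mdot (skew B) (skew B) +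
      2 / 9 * d * mdot (B.trace • (1 : Mat3)) (B.trace • (1 : Mat3))) := by
  simp [mdot, dev, sym, skew, Matrix.trace, Fin.sum_univ_three, Matrix.one_apply]
  ring

theorem tnormSq_onSlices (L : Mat3 → Mat3) (M : Tensor3) :
    tnormSq (onSlices L M) = ∑ k, mdot (L (Matrix.of fun i j => M i j k))
      (L (Matrix.of fun i j => M i j k)) := by
  simp only [tnormSq, mdot, onSlices, ← sq]
  rw [Finset.sum_comm]
  conv_rhs => rw [Finset.sum_comm]; enter [2, j]; rw [Finset.sum_comm]
  rw [Finset.sum_comm]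

theorem tensorInner_eq_sum_mdot (M N : Tensor3) :
    tensorInner M N = ∑ k, mdot (Matrix.of fun i j => M i j k) (Matrix.of fun i j => N i j k) := by
  simp only [tensorInner, mdot, Matrix.of_apply]
  rw [Finset.sum_comm]
  conv_rhs => rw [Finset.sum_comm]; enter [2, j]; rw [Finset.sum_comm]
  rw [Finset.sum_comm]

theorem mdot_smul_left (r : ℝ) (A B : Mat3) : mdot (r • A) B = r * mdot A B := by
  simp [mdot, Finset.mul_sum, mul_assoc]

theorem Wcurv_add_smul (c : CurvParams) (M N : Tensor3) (r : ℝ) :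
    Wcurv c (M + r • N) =
      Wcurv c M + r * tensorInner (onSlices (curvMap c) M) N + r ^ 2 * Wcurv c N := by
  have hslice : ∀ k, (Matrix.of fun i j => (M + r • N) i j k : Mat3) =
      Matrix.of (fun i j => M i j k) + r • Matrix.of (fun i j => N i j k) := fun k => by
    ext i j
    simp
  have hσ : ∀ k B, mdot (Matrix.of fun i j => onSlices (curvMap c) M i j k) B =
      c.μ * c.Lc ^ 2 * mdot (c.a₁ • dev (sym (Matrix.of fun i j => M i j k)) +
        c.a₂ • skew (Matrix.of fun i j => M i j k) +
        (2 / 3 * c.a₃) • ((Matrix.of fun i j => M i j k : Mat3).trace • (1 : Mat3))) B :=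
    fun k B => mdot_smul_left _ _ B
  simp only [Wcurv, tnormSq_onSlices, tensorInner_eq_sum_mdot, hslice, hσ,
    Finset.mul_sum, ← Finset.sum_add_distrib]
  refine Finset.sum_congr rfl fun k _ => ?_
  linear_combination (c.μ * c.Lc ^ 2 / 2) * slice_energy_expand c.a₁ c.a₂ c.a₃ r
    (Matrix.of fun i j => M i j k) (Matrix.of fun i j => N i j k)

theorem Wcurv_eq_tensorInner (c : CurvParams) (M : Tensor3) :
    Wcurv c M = 1 / 2 * tensorInner (onSlices (curvMap c) M) M := by
  have h0 : Wcurv c 0 = 0 := by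
    have h : tensorInner (onSlices (curvMap c) 0) 0 = 0 := by simp [tensorInner]
    have := Wcurv_add_smul c 0 0 1
    rw [h, smul_zero, add_zero] at this
    linarith
  -- Expanding the density at `M - M = 0` gives `0 = 2 W - ⟨σ, M⟩`, with `σ` the stress of `M`.
  have h := Wcurv_add_smul c M M (-1)
  rw [neg_one_smul, add_neg_cancel, h0] at h
  linarith

theorem memLp_onSlices {X : Type*} [MeasurableSpace X] {μ : Measure X} (L : Mat3 →ₗ[ℝ] Mat3)
    {M : X → Tensor3} (hM : ∀ i j k, MemLp (fun x => M x i j k) 2 μ) (i j k : Fin 3) :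
    MemLp (fun x => onSlices L (M x) i j k) 2 μ := by
  simp_rw [onSlices_linearMap_apply]
  exact memLp_finsetSum _ fun p _ => (hM p.1 p.2 k).mul_const _

/-! ### The first variation -/

/-- The expansion in `t` is an exact polynomial with integrable coefficients, so no exchange of
limit and integral occurs and no sign of the parameters matters. -/
theorem hasDerivAt_curvEnergy (c : CurvParams) {Ω : Set Vec3} (hΩ : IsOpen Ω)
    (hΩb : Bornology.IsBounded Ω) {P δP : Vec3 → Mat3} {G G' : Vec3 → Tensor3}
    (hP : HasWeakGrad Ω P G) (hδ : HasWeakGrad Ω δP G') :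
    HasDerivAt (fun t : ℝ => curvEnergy c Ω (P + t • δP))
      (∫ x in Ω, tensorInner (onSlices (curvMap c) (G x)) (G' x)) 0 := by
  have hW : ∀ {Q : Vec3 → Mat3} {H : Vec3 → Tensor3}, HasWeakGrad Ω Q H →
      Integrable (fun x => Wcurv c (H x)) (volume.restrict Ω) := fun hH => by
    simp_rw [Wcurv_eq_tensorInner]
    exact (integrable_tensorInner (memLp_onSlices (curvMap c) hH.2.1) hH.2.1).const_mul _
  have hI := integrable_tensorInner (memLp_onSlices (curvMap c) hP.2.1) hδ.2.1
  have hE : ∀ t : ℝ, curvEnergy c Ω (P + t • δP) = (∫ x in Ω, Wcurv c (G x)) +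
      t * (∫ x in Ω, tensorInner (onSlices (curvMap c) (G x)) (G' x)) +
      t ^ 2 * ∫ x in Ω, Wcurv c (G' x) := fun t => by
    have hi : Integrable (fun x => Wcurv c (G x) +
        t * tensorInner (onSlices (curvMap c) (G x)) (G' x)) (volume.restrict Ω) :=
      (hW hP).add (hI.const_mul t)
    rw [curvEnergy, ← integral_const_mul, ← integral_const_mul,
      ← integral_add (hW hP) (hI.const_mul t),
      ← integral_add hi ((hW hδ).const_mul (t ^ 2))]
    refine integral_congr_ae ?_
    filter_upwards [weakGrad_ae_eq hΩ hΩb (hP.add_smul hΩb hδ t)] with x hx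
    rw [hx]
    exact Wcurv_add_smul c (G x) (G' x) t
  simp_rw [hE]
  have h := (((hasDerivAt_id (0 : ℝ)).mul_const
    (∫ x in Ω, tensorInner (onSlices (curvMap c) (G x)) (G' x))).const_add
    (∫ x in Ω, Wcurv c (G x))).add
    (((hasDerivAt_id (0 : ℝ)).pow 2).mul_const (∫ x in Ω, Wcurv c (G' x)))
  simpa using! h

theorem hasDerivAt_curvEnergy_of_isTrace (c : CurvParams) {Ω : Set Vec3} (hΩ : IsOpen Ω)
    (hΩb : Bornology.IsBounded Ω) (hΩ2 : HasC2Boundary Ω) {P δP g : Vec3 → Mat3}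
    (hP : ∀ i j, ContDiff ℝ 2 fun x => P x i j) (h : IsTrace Ω δP g) :
    HasDerivAt (fun t : ℝ => curvEnergy c Ω (P + t • δP))
      ((∫ x, mdot (tdot (momentStress c P x) (outerNormal Ω x)) (g x) ∂surf Ω) -
        ∫ x in Ω, mdot (DIV (momentStress c P) x) (δP x)) 0 := by
  rw [← h.integral_tensorInner_weakGrad hΩ hΩb hΩ2 (contDiff_momentStress c hP)]
  simp_rw [momentStress_eq c (fun i j => (hP i j).differentiable two_ne_zero)]
  exact hasDerivAt_curvEnergy c hΩ hΩb (hasWeakGrad_grad hΩb fun i j => (hP i j).of_le one_le_two)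
    (hasWeakGrad_weakGrad h.1)

theorem curvVariation_eq_of_isTrace (c : CurvParams) {Ω : Set Vec3} (hΩ : IsOpen Ω)
    (hΩb : Bornology.IsBounded Ω) (hΩ2 : HasC2Boundary Ω) {P δP g : Vec3 → Mat3}
    (hP : ∀ i j, ContDiff ℝ 2 fun x => P x i j) (h : IsTrace Ω δP g) :
    curvVariation c Ω P δP =
      (∫ x, mdot (tdot (momentStress c P x) (outerNormal Ω x)) (g x) ∂surf Ω) -
        ∫ x in Ω, mdot (DIV (momentStress c P) x) (δP x) :=
  (hasDerivAt_curvEnergy_of_isTrace c hΩ hΩb hΩ2 hP h).deriv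

/-! ### Algebra on the boundary -/

theorem sum_sq_eq_one {u : Vec3} (hu : ‖u‖ = 1) : u 0 ^ 2 + u 1 ^ 2 + u 2 ^ 2 = 1 := by
  have := EuclideanSpace.real_norm_sq_eq u
  rw [hu, Fin.sum_univ_three] at this
  linarith

theorem mul_dyad_apply (A : Mat3) (u : Vec3) (i j : Fin 3) :
    (A * dyad u) i j = vdot A u i * u j := by
  simp [Matrix.mul_apply, dyad, vdot, Matrix.mulVec, dotProduct, Finset.sum_mul, mul_assoc]

theorem mul_dyad_eq_zero_iff {u : Vec3} (hu : ‖u‖ = 1) (A : Mat3) :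
    A * dyad u = 0 ↔ vdot A u = 0 := by
  constructor
  · intro h
    funext i
    have h1 : ∀ j, vdot A u i * u j = 0 := fun j => by rw [← mul_dyad_apply, h]; rfl
    have h2 := sum_sq_eq_one hu
    change vdot A u i = 0
    linear_combination u 0 * h1 0 + u 1 * h1 1 + u 2 * h1 2 - vdot A u i * h2
  · intro h
    ext i j
    rw [mul_dyad_apply, h]
    simp

/-- For a unit vector `u ⊗ u` is a symmetric idempotent, so one of the two projections is redundant.
-/
theorem mdot_mul_dyad {u : Vec3} (hu : ‖u‖ = 1) (A B : Mat3) :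
    mdot (A * dyad u) (B * dyad u) = mdot A (B * dyad u) := by
  have h2 := sum_sq_eq_one hu
  simp only [mdot, mul_dyad_apply]
  refine Finset.sum_congr rfl fun i _ => ?_
  have : vdot A u i = A i 0 * u 0 + A i 1 * u 1 + A i 2 * u 2 := by
    simp [vdot, Matrix.mulVec, dotProduct, Fin.sum_univ_three]
  simp only [Fin.sum_univ_three]
  linear_combination (vdot A u i * vdot B u i) * h2 + vdot B u i * this

/-- For each row `a`, the identity `a = ⟨a, u⟩ u + u × (a × u)` loses its last term. -/
theorem eq_mul_dyad_of_rowCross {u : Vec3} (hu : ‖u‖ = 1) {A : Mat3} (h : rowCross A u = 0) :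
    A = A * dyad u := by
  have h2 := sum_sq_eq_one hu
  ext i j
  rw [mul_dyad_apply]
  have hv : vdot A u i = A i 0 * u 0 + A i 1 * u 1 + A i 2 * u 2 := by
    simp [vdot, Matrix.mulVec, dotProduct, Fin.sum_univ_three]
  have hc : ∀ j, rowCross A u i j = 0 := fun j => by rw [h]; rfl
  have c0 := hc 0
  have c1 := hc 1
  have c2 := hc 2
  simp [rowCross, cross_apply] at c0 c1 c2
  rw [hv]
  fin_cases j
  · simp only [Fin.zero_eta]
    linear_combination -A i 0 * h2 - u 2 * c1 + u 1 * c2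
  · simp only [Fin.mk_one]
    linear_combination -A i 1 * h2 + u 2 * c0 - u 0 * c2
  · simp only [Fin.reduceFinMk]
    linear_combination -A i 2 * h2 - u 1 * c0 + u 0 * c1

theorem rowCross_smul_dyadic (a : Fin 3 → ℝ) (s : ℝ) (u : Vec3) :
    rowCross (Matrix.of fun i j => a i * (s * u j)) u = 0 := by
  ext i j
  simp only [rowCross, Matrix.of_apply, cross_apply]
  fin_cases j <;> simp <;> ring

theorem mdot_self_pos {A : Mat3} (hA : A ≠ 0) : 0 < mdot A A := by
  have h0 : 0 ≤ mdot A A :=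
    Finset.sum_nonneg fun i _ => Finset.sum_nonneg fun j _ => mul_self_nonneg _
  refine h0.lt_of_ne fun h => hA ?_
  ext i j
  have h1 := (Finset.sum_eq_zero_iff_of_nonneg fun i _ =>
    Finset.sum_nonneg fun j _ => mul_self_nonneg (A i j)).1 h.symm i (Finset.mem_univ i)
  have h2 := (Finset.sum_eq_zero_iff_of_nonneg fun j _ => mul_self_nonneg (A i j)).1 h1 j
    (Finset.mem_univ j)
  simpa using h2

/-! ### Localization -/

theorem eq_zero_of_notMem_ball {x₀ : Vec3} (φ : ContDiffBump x₀) {x : Vec3}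
    (hx : x ∉ Metric.ball x₀ φ.rOut) : φ x = 0 := by
  rw [← φ.support_eq] at hx
  exact Function.notMem_support.1 hx

/-- A nonnegative integrand with zero integral vanishes almost everywhere, yet this one is positive
on almost all of the ball. -/
theorem measure_ball_eq_zero_of_integral_bump {μ : Measure Vec3} {x₀ : Vec3} (φ : ContDiffBump x₀)
    {h : Vec3 → ℝ} (hpos : ∀ᵐ x ∂μ, x ∈ Metric.ball x₀ φ.rOut → 0 < h x)
    (hi : Integrable (fun x => φ x * h x) μ) (h0 : ∫ x, φ x * h x ∂μ = 0) :
    μ (Metric.ball x₀ φ.rOut) = 0 := by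
  have hnn : 0 ≤ᵐ[μ] fun x => φ x * h x := by
    filter_upwards [hpos] with x hx
    by_cases hxb : x ∈ Metric.ball x₀ φ.rOut
    · exact mul_nonneg φ.nonneg (hx hxb).le
    · simp [eq_zero_of_notMem_ball φ hxb]
  have hz := (integral_eq_zero_iff_of_nonneg_ae hnn hi).1 h0
  refine measure_eq_zero_iff_ae_notMem.2 ?_
  filter_upwards [hpos, hz] with x hx hzx hxb
  have hφ : 0 < φ x := φ.pos_of_mem_ball hxb
  exact absurd hzx (mul_pos hφ (hx hxb)).ne'

theorem exists_contDiffBump_subset {x₀ : Vec3} {N : Set Vec3} (hN : N ∈ 𝓝 x₀) :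
    ∃ φ : ContDiffBump x₀, Metric.closedBall x₀ φ.rOut ⊆ N := by
  obtain ⟨r, hr, hrN⟩ := Metric.nhds_basis_closedBall.mem_iff.1 hN
  exact ⟨⟨r / 2, r, by positivity, by linarith⟩, hrN⟩

theorem mdot_smul_right (r : ℝ) (A B : Mat3) : mdot A (r • B) = r * mdot A B := by
  simp [mdot, Finset.mul_sum, mul_left_comm]

theorem continuousOn_mdot {s : Set Vec3} {A B : Vec3 → Mat3}
    (hA : ∀ i j, ContinuousOn (fun x => A x i j) s)
    (hB : ∀ i j, ContinuousOn (fun x => B x i j) s) :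
    ContinuousOn (fun x => mdot (A x) (B x)) s :=
  continuousOn_finsetSum _ fun i _ => continuousOn_finsetSum _ fun j _ => (hA i j).mul (hB i j)

theorem memHsharp_of_contDiff {Ω Γ : Set Vec3} (hΩ : IsOpen Ω) (hΩb : Bornology.IsBounded Ω)
    (hΩ2 : HasC2Boundary Ω) (hΓ : MeasurableSet Γ) {Q : Vec3 → Mat3}
    (hQ : ∀ i j, ContDiff ℝ 1 fun x => Q x i j)
    (h : ∀ x ∈ Γ, rowCross (Q x) (outerNormal Ω x) = 0) : MemHsharp Ω Γ Q :=
  ⟨Q, isTrace_of_contDiff hΩ hΩb hΩ2 hQ, (ae_restrict_iff' hΓ).2 (Eventually.of_forall h)⟩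

theorem rowCross_smul (r : ℝ) (A : Mat3) (u : Vec3) : rowCross (r • A) u = r • rowCross A u := by
  ext i j
  simp only [rowCross, Matrix.of_apply, Matrix.smul_apply, cross_apply]
  fin_cases j <;> simp <;> ring

theorem rowCross_zero (u : Vec3) : rowCross 0 u = 0 := by
  simpa using rowCross_smul 0 0 u

theorem contDiff_bump_mul {x₀ : Vec3} (φ : ContDiffBump x₀) {B : Vec3 → Mat3}
    (hB : ∀ i j, ContDiff ℝ 1 fun x => B x i j) (i j : Fin 3) :
    ContDiff ℝ 1 fun x => (φ x • B x) i j :=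
  (φ.contDiff (n := 1)).mul (hB i j)

section Localization

variable {Ω Γ : Set Vec3} {c : CurvParams} {P : Vec3 → Mat3}

/-- The test field is a bump supported in `Ω` times the constant value of the divergence at `x₀`; it
is admissible and sees no boundary term. -/
theorem DIV_momentStress_eq_zero (hΩ : IsOpen Ω) (hΩb : Bornology.IsBounded Ω)
    (hΩ2 : HasC2Boundary Ω) (hΓ : MeasurableSet Γ) (hΓf : Γ ⊆ frontier Ω)
    (hP : ∀ i j, ContDiff ℝ 2 fun x => P x i j)
    (h0 : ∀ δP, MemHsharp Ω Γ δP → curvVariation c Ω P δP = 0) {x₀ : Vec3} (hx₀ : x₀ ∈ Ω) :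
    DIV (momentStress c P) x₀ = 0 := by
  by_contra hne
  set A := DIV (momentStress c P) x₀ with hA
  have hm := contDiff_momentStress c hP
  let h : Vec3 → ℝ := fun x => mdot (DIV (momentStress c P) x) A
  have hc : Continuous h := continuousOn_univ.1
    (continuousOn_mdot (fun i j => (continuous_DIV hm i j).continuousOn)
      fun i j => continuousOn_const)
  have hev : ∀ᶠ x in 𝓝 x₀, 0 < h x := hc.continuousAt.eventually_const_lt (mdot_self_pos hne)
  obtain ⟨φ, hφ⟩ := exists_contDiffBump_subset (hev.and (hΩ.mem_nhds hx₀))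
  have hfr : ∀ x ∈ frontier Ω, φ x = 0 := fun x hx => by
    refine eq_zero_of_notMem_ball φ fun hb => ?_
    rw [hΩ.frontier_eq] at hx
    exact hx.2 (hφ (Metric.ball_subset_closedBall hb)).2
  have hQ := contDiff_bump_mul φ (B := fun _ => A) fun i j => contDiff_const
  have hmem : MemHsharp Ω Γ fun x => φ x • A :=
    memHsharp_of_contDiff hΩ hΩb hΩ2 hΓ hQ fun x hx => by
      rw [hfr x (hΓf hx), zero_smul, rowCross_zero]
  have hv := h0 _ hmem
  rw [curvVariation_eq_of_isTrace c hΩ hΩb hΩ2 hP (isTrace_of_contDiff hΩ hΩb hΩ2 hQ)] at hv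
  have hb : ∫ x, mdot (tdot (momentStress c P x) (outerNormal Ω x)) (φ x • A) ∂surf Ω = 0 := by
    refine integral_eq_zero_of_ae ?_
    filter_upwards [ae_surf_mem_frontier Ω] with x hx
    rw [mdot_smul_right, hfr x hx, zero_mul]
    rfl
  rw [hb, zero_sub, neg_eq_zero] at hv
  simp_rw [mdot_smul_right] at hv
  have hz := measure_ball_eq_zero_of_integral_bump φ (h := h) (μ := volume.restrict Ω)
    (Eventually.of_forall fun x hx => (hφ (Metric.ball_subset_closedBall hx)).1)
    (memLp_one_iff_integrable.1 (memLp_of_continuous hΩb (φ.continuous.mul hc) 1)) hv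
  rw [Measure.restrict_apply Metric.isOpen_ball.measurableSet, Set.inter_eq_left.2
    fun x hx => (hφ (Metric.ball_subset_closedBall hx)).2] at hz
  exact (Metric.measure_ball_pos volume x₀ φ.rOut_pos).ne' hz

/-- If the boundary term vanishes for a `C¹` field times every bump function near the boundary point
`x₀`, then its density is not positive at `x₀`. -/
theorem not_boundary_density_pos (hΩ : IsOpen Ω) (hΩb : Bornology.IsBounded Ω)
    (hΩ2 : HasC2Boundary Ω) (hΓ : MeasurableSet Γ) (hP : ∀ i j, ContDiff ℝ 2 fun x => P x i j)
    (h0 : ∀ δP, MemHsharp Ω Γ δP → curvVariation c Ω P δP = 0)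
    (hdiv : ∀ x ∈ Ω, DIV (momentStress c P) x = 0) {x₀ : Vec3} (hx₀ : x₀ ∈ frontier Ω)
    {B : Vec3 → Mat3} (hB : ∀ i j, ContDiff ℝ 1 fun x => B x i j)
    (hBΓ : ∀ᶠ x in 𝓝 x₀, x ∈ Γ → rowCross (B x) (outerNormal Ω x) = 0) :
    ¬0 < mdot (tdot (momentStress c P x₀) (outerNormal Ω x₀)) (B x₀) := by
  intro hpos
  have hm := contDiff_momentStress c hP
  let h : Vec3 → ℝ := fun x => mdot (tdot (momentStress c P x) (outerNormal Ω x)) (B x)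
  have hc : ContinuousOn h (frontier Ω) := continuousOn_mdot
    (continuousOn_tdot_outerNormal hΩ hΩ2 fun i j k => (hm i j k).continuous)
    fun i j => (hB i j).continuous.continuousOn
  have hev : ∀ᶠ x in 𝓝 x₀, x ∈ frontier Ω → 0 < h x :=
    eventually_nhdsWithin_iff.1 ((hc x₀ hx₀).eventually_const_lt hpos)
  -- The support is so small that on it the boundary density stays positive and the tangential
  -- constraint holds.
  obtain ⟨φ, hφ⟩ := exists_contDiffBump_subset (hev.and hBΓ)
  have hQ := contDiff_bump_mul φ hB
  have hmem : MemHsharp Ω Γ fun x => φ x • B x :=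
    memHsharp_of_contDiff hΩ hΩb hΩ2 hΓ hQ fun x hx => by
      by_cases hb : x ∈ Metric.ball x₀ φ.rOut
      · rw [rowCross_smul, (hφ (Metric.ball_subset_closedBall hb)).2 hx, smul_zero]
      · rw [eq_zero_of_notMem_ball φ hb, zero_smul, rowCross_zero]
  have hv := h0 _ hmem
  rw [curvVariation_eq_of_isTrace c hΩ hΩb hΩ2 hP (isTrace_of_contDiff hΩ hΩb hΩ2 hQ)] at hv
  have hb : ∫ x in Ω, mdot (DIV (momentStress c P) x) (φ x • B x) = 0 := by
    refine setIntegral_eq_zero_of_forall_eq_zero fun x hx => ?_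
    rw [hdiv x hx]
    simp [mdot]
  rw [hb, sub_zero] at hv
  simp_rw [mdot_smul_right] at hv
  have hz := measure_ball_eq_zero_of_integral_bump φ (h := h) (μ := surf Ω)
    (by
      filter_upwards [ae_surf_mem_frontier Ω] with x hx hxb
      exact (hφ (Metric.ball_subset_closedBall hxb)).1 hx)
    (integrable_surf_of_continuousOn hΩ hΩb hΩ2 (φ.continuous.continuousOn.mul hc)) hv
  exact (surf_pos_of_mem_nhds hΩ hΩ2 hx₀ (Metric.ball_mem_nhds x₀ φ.rOut_pos)).ne' hz

/-- The natural test field `a ⊗ ν` lives only on the boundary; `a ⊗ ∇ρ` extends it, up to a positive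
factor there. It is `C¹` because `ρ` is `C²`, and its rows are parallel to `ν` on the boundary near
`x₀`. With `a` the normal part of the traction, the density at `x₀` is `‖∇ρ‖ |a|²`. -/
theorem vdot_traction_eq_zero (hΩ : IsOpen Ω) (hΩb : Bornology.IsBounded Ω)
    (hΩ2 : HasC2Boundary Ω) (hΓ : MeasurableSet Γ) (hΓf : Γ ⊆ frontier Ω)
    (hP : ∀ i j, ContDiff ℝ 2 fun x => P x i j)
    (h0 : ∀ δP, MemHsharp Ω Γ δP → curvVariation c Ω P δP = 0)
    (hdiv : ∀ x ∈ Ω, DIV (momentStress c P) x = 0) {x₀ : Vec3} (hx₀ : x₀ ∈ frontier Ω) :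
    vdot (tdot (momentStress c P x₀) (outerNormal Ω x₀)) (outerNormal Ω x₀) = 0 := by
  obtain ⟨ρ, hρ⟩ := hΩ2 x₀ hx₀
  have hgrad : ∀ x ∈ frontier Ω, IsDefiningFunctionAt Ω x ρ →
      ∀ j, pderiv j ρ x = ‖gradient ρ x‖ * outerNormal Ω x j := fun x hx hx' j => by
    rw [outerNormal_eq hΩ hx hx', ← gradient_apply]
    have := norm_ne_zero_iff.2 hx'.2.1
    simp [mul_inv_cancel_left₀ this]
  by_contra hne
  set S := tdot (momentStress c P x₀) (outerNormal Ω x₀) with hS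
  set a := vdot S (outerNormal Ω x₀) with ha
  refine not_boundary_density_pos hΩ hΩb hΩ2 hΓ hP h0 hdiv hx₀
    (B := fun x => Matrix.of fun i j => a i * pderiv j ρ x)
    (fun i j => contDiff_const.mul (contDiff_pderiv hρ.1 j)) ?_ ?_
  · filter_upwards [hρ.eventually] with x hx hxΓ
    simp_rw [hgrad x (hΓf hxΓ) hx]
    exact rowCross_smul_dyadic _ _ _
  · have e : mdot S (Matrix.of fun i j => a i * pderiv j ρ x₀) =
        ‖gradient ρ x₀‖ * ∑ i, a i * a i := by
      simp only [hgrad x₀ hx₀ hρ, mdot, Matrix.of_apply, Finset.mul_sum]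
      refine Finset.sum_congr rfl fun i _ => ?_
      have : a i = S i 0 * outerNormal Ω x₀ 0 + S i 1 * outerNormal Ω x₀ 1 +
          S i 2 * outerNormal Ω x₀ 2 := by
        simp [ha, vdot, Matrix.mulVec, dotProduct, Fin.sum_univ_three]
      rw [Fin.sum_univ_three]
      linear_combination (-‖gradient ρ x₀‖ * a i) * this
    rw [e]
    refine mul_pos (norm_pos_iff.2 hρ.2.1) ?_
    obtain ⟨i, hi⟩ := Function.ne_iff.1 hne
    exact Finset.sum_pos' (fun i _ => mul_self_nonneg _)
      ⟨i, Finset.mem_univ i, mul_self_pos.2 hi⟩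

/-- Near a point off the closure of `Γ` there is no constraint, so the traction itself, frozen at
`x₀`, is a permitted test value. -/
theorem traction_eq_zero (hΩ : IsOpen Ω) (hΩb : Bornology.IsBounded Ω)
    (hΩ2 : HasC2Boundary Ω) (hΓ : MeasurableSet Γ) (hP : ∀ i j, ContDiff ℝ 2 fun x => P x i j)
    (h0 : ∀ δP, MemHsharp Ω Γ δP → curvVariation c Ω P δP = 0)
    (hdiv : ∀ x ∈ Ω, DIV (momentStress c P) x = 0) {x₀ : Vec3}
    (hx₀ : x₀ ∈ frontier Ω \ closure Γ) :
    tdot (momentStress c P x₀) (outerNormal Ω x₀) = 0 := by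
  by_contra hne
  refine not_boundary_density_pos hΩ hΩb hΩ2 hΓ hP h0 hdiv hx₀.1
    (B := fun _ => tdot (momentStress c P x₀) (outerNormal Ω x₀))
    (fun i j => contDiff_const) ?_ (mdot_self_pos hne)
  filter_upwards [isClosed_closure.isOpen_compl.mem_nhds hx₀.2] with x hx hxΓ
  exact absurd (subset_closure hxΓ) hx

end Localization

/-- The boundary term splits into its parts on `Γ` and off the closure of `Γ`. -/
theorem integral_surf_split {Ω Γ : Set Vec3}
    (hnull : surf Ω (closure Γ \ Γ) = 0) {f : Vec3 → ℝ} (hf : Integrable f (surf Ω)) :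
    ∫ x, f x ∂surf Ω =
      (∫ x in Γ, f x ∂surf Ω) + ∫ x in frontier Ω \ closure Γ, f x ∂surf Ω := by
  have hd : Disjoint Γ (frontier Ω \ closure Γ) :=
    Set.disjoint_left.2 fun x hx hx' => hx'.2 (subset_closure hx)
  have hm : MeasurableSet (frontier Ω \ closure Γ) :=
    isClosed_frontier.measurableSet.diff isClosed_closure.measurableSet
  rw [← setIntegral_union hd hm hf.integrableOn hf.integrableOn]
  refine (setIntegral_eq_integral_of_ae_compl_eq_zero ?_).symm
  -- The only boundary points in neither piece are those of `closure Γ \ Γ`.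
  filter_upwards [ae_surf_mem_frontier Ω, measure_eq_zero_iff_ae_notMem.1 hnull] with x hx hx' hxu
  refine absurd ?_ hxu
  by_cases hxΓ : x ∈ Γ
  · exact Or.inl hxΓ
  · exact Or.inr ⟨hx, fun hcl => hx' ⟨hcl, hxΓ⟩⟩

theorem curvVariation_eq_split (c : CurvParams) {Ω Γ : Set Vec3} (hΩ : IsOpen Ω)
    (hΩb : Bornology.IsBounded Ω) (hΩ2 : HasC2Boundary Ω) (hΓ : MeasurableSet Γ)
    (hΓf : Γ ⊆ frontier Ω) (hnull : surf Ω (closure Γ \ Γ) = 0) {P δP g : Vec3 → Mat3}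
    (hP : ∀ i j, ContDiff ℝ 2 fun x => P x i j) (h : IsTrace Ω δP g)
    (hg : ∀ᵐ x ∂(surf Ω).restrict Γ, g x = g x * dyad (outerNormal Ω x)) :
    curvVariation c Ω P δP =
      (∫ x in Γ, mdot (tdot (momentStress c P x) (outerNormal Ω x) * dyad (outerNormal Ω x))
          (g x * dyad (outerNormal Ω x)) ∂(surf Ω)) +
      (∫ x in frontier Ω \ closure Γ,
          mdot (tdot (momentStress c P x) (outerNormal Ω x)) (g x) ∂(surf Ω)) -
      ∫ x in Ω, mdot (DIV (momentStress c P) x) (δP x) := by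
  have hm := contDiff_momentStress c hP
  have hi : Integrable (fun x => mdot (tdot (momentStress c P x) (outerNormal Ω x)) (g x))
      (surf Ω) := integrable_mdot (fun i j => memLp_surf_of_continuousOn hΩ hΩb hΩ2
        (continuousOn_tdot_outerNormal hΩ hΩ2 (fun i j k => (hm i j k).continuous) i j) 2) h.2.1
  rw [curvVariation_eq_of_isTrace c hΩ hΩb hΩ2 hP h, integral_surf_split hnull hi]
  congr 2
  refine integral_congr_ae ?_
  filter_upwards [hg, ae_restrict_mem hΓ] with x hx hxΓ
  rw [mdot_mul_dyad (norm_outerNormal hΩ hΩ2 (hΓf hxΓ)), ← hx]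

end Micromorphic

end

/-! ### First variation, field equation and natural boundary conditions -/

open Micromorphic
theorem mainTheorem2
    (Ω Γ : Set Vec3) (hΩ : IsOpen Ω) (hΩb : Bornology.IsBounded Ω) (hΩ2 : HasC2Boundary Ω)
    (hΓ : ∃ O : Set Vec3, IsOpen O ∧ Γ = O ∩ frontier Ω)
    (c : CurvParams)
    (P : Vec3 → Mat3) (hP : ∀ i j, ContDiff ℝ 2 (fun x => P x i j)) (hPs : MemHsharp Ω Γ P) :
    -- the first variation in an admissible direction `δP` with boundary values `g`
    (∀ δP g : Vec3 → Mat3, IsTrace Ω δP g → TangentiallyZero Ω Γ g →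
      (∀ᵐ x ∂(surf Ω).restrict Γ, g x = g x * dyad (outerNormal Ω x)) ∧
      DifferentiableAt ℝ (fun t : ℝ => curvEnergy c Ω (P + t • δP)) 0 ∧
      (surf Ω (closure Γ \ Γ) = 0 →
        curvVariation c Ω P δP =
          (∫ x in Γ, mdot
              (tdot (momentStress c P x) (outerNormal Ω x) * dyad (outerNormal Ω x))
              (g x * dyad (outerNormal Ω x)) ∂(surf Ω)) +
          (∫ x in frontier Ω \ closure Γ,
              mdot (tdot (momentStress c P x) (outerNormal Ω x)) (g x) ∂(surf Ω)) -
          ∫ x in Ω, mdot (DIV (momentStress c P) x) (δP x))) ∧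
    -- vanishing of the first variation yields the bulk equation and the boundary conditions
    ((∀ δP, MemHsharp Ω Γ δP → curvVariation c Ω P δP = 0) →
      (∀ x ∈ Ω, DIV (momentStress c P) x = 0) ∧
      (∀ x ∈ Γ,
        tdot (momentStress c P x) (outerNormal Ω x) * dyad (outerNormal Ω x) = 0) ∧
      (∀ x ∈ frontier Ω \ closure Γ, tdot (momentStress c P x) (outerNormal Ω x) = 0)) ∧
    -- and conversely
    (surf Ω (closure Γ \ Γ) = 0 →
      (∀ x ∈ Ω, DIV (momentStress c P) x = 0) →
      (∀ x ∈ Γ,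
        tdot (momentStress c P x) (outerNormal Ω x) * dyad (outerNormal Ω x) = 0) →
      (∀ x ∈ frontier Ω \ closure Γ, tdot (momentStress c P x) (outerNormal Ω x) = 0) →
      ∀ δP, MemHsharp Ω Γ δP → curvVariation c Ω P δP = 0) ∧
    -- the two forms of the new Neumann-type condition on `Γ` are equivalent
    (∀ x ∈ Γ,
      (tdot (momentStress c P x) (outerNormal Ω x) * dyad (outerNormal Ω x) = 0 ↔
        vdot (tdot (momentStress c P x) (outerNormal Ω x)) (outerNormal Ω x) = 0)) := by
  obtain ⟨O, hO, hΓO⟩ := hΓ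
  have hΓm : MeasurableSet Γ := hΓO ▸ hO.measurableSet.inter isClosed_frontier.measurableSet
  have hΓf : Γ ⊆ frontier Ω := hΓO ▸ Set.inter_subset_right
  have hdyad : ∀ g : Vec3 → Mat3, TangentiallyZero Ω Γ g →
      ∀ᵐ x ∂(surf Ω).restrict Γ, g x = g x * dyad (outerNormal Ω x) := fun g hg => by
    filter_upwards [hg, ae_restrict_mem hΓm] with x hx hxΓ
    exact eq_mul_dyad_of_rowCross (norm_outerNormal hΩ hΩ2 (hΓf hxΓ)) hx
  refine ⟨fun δP g h hg => ⟨hdyad g hg,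
    (hasDerivAt_curvEnergy_of_isTrace c hΩ hΩb hΩ2 hP h).differentiableAt, fun hnull =>
      curvVariation_eq_split c hΩ hΩb hΩ2 hΓm hΓf hnull hP h (hdyad g hg)⟩, fun h0 => ?_,
    fun hnull hdiv hΓ0 hc0 δP hδ => ?_,
    fun x hx => mul_dyad_eq_zero_iff (norm_outerNormal hΩ hΩ2 (hΓf hx)) _⟩
  -- The bulk equation comes first: it removes the volume term from the boundary tests.
  · have hdiv : ∀ x ∈ Ω, DIV (momentStress c P) x = 0 := fun x hx =>
      DIV_momentStress_eq_zero hΩ hΩb hΩ2 hΓm hΓf hP h0 hx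
    exact ⟨hdiv, fun x hx => (mul_dyad_eq_zero_iff (norm_outerNormal hΩ hΩ2 (hΓf hx)) _).2
      (vdot_traction_eq_zero hΩ hΩb hΩ2 hΓm hΓf hP h0 hdiv (hΓf hx)),
      fun x hx => traction_eq_zero hΩ hΩb hΩ2 hΓm hP h0 hdiv hx⟩
  · obtain ⟨g, h, hg⟩ := hδ
    have hz : ∀ B : Mat3, mdot 0 B = 0 := fun B => by simp [mdot]
    rw [curvVariation_eq_split c hΩ hΩb hΩ2 hΓm hΓf hnull hP h (hdyad g hg),
      setIntegral_eq_zero_of_forall_eq_zero fun x hx => by rw [hΓ0 x hx, hz],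
      setIntegral_eq_zero_of_forall_eq_zero fun x hx => by rw [hc0 x hx, hz],
      setIntegral_eq_zero_of_forall_eq_zero fun x hx => by rw [hdiv x hx, hz]]
    simp
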